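/- Setting. A submodular rule is a function $w:\mathbb{N}\to\mathbb{R}$ with $w(0)=0$ and $w(j)>0$ for $j\ge 1$ whose increments $w(j+1)-w(j)$, $j\ge 0$, are non-negative and non-increasing in $j$. Its curvature is $1-\lim_{n\to\infty}(w(n+1)-w(n))/w(1)\in[0,1]$. Fix $C\in[0,1]$ and let $\mathcal{W}$ be the set of all submodular rules of curvature at most $C$. A utility design for $\mathcal{W}$ is a map $\Gamma$ that assigns to every $w\in\mathcal{W}$ a submodular rule $\Gamma(w)$ with $\Gamma(w)(1)=w(1)$; the common-interest design is $\Gamma_{\rm id}(w)=w$. A game $G$ induced by $\mathcal{W}$ and $\Gamma$ consists of agents $1,\dots,n$, a finite set $\mathcal{R}$ of resources, a non-empty action set $\mathcal{A}_i\subseteq 2^{\mathcal{R}}$ for each agent $i$, and welfare rules $w_r\in\mathcal{W}$ $(r\in\mathcal{R})$. Write $|a|_r$ for the number of agents $i$ with $r\in a_i$. The welfare of $a=(a_1,\dots,a_n)$ is $W(a)=\sum_{r} w_r(|a|_r)$, and the utility of every agent is $U(a)=\sum_{r}\Gamma(w_r)(|a|_r)$. It is assumed that $\max_{a\in\prod_i\mathcal{A}_i}W(a)>0$.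 A round-robin best response trajectory $a(0),a(1),\dots$ starts at $a(0)=(\varnothing,\dots,\varnothing)$; at the steps $1,2,3,\dots$ the agents $1,\dots,n,1,\dots,n,\dots$ in turn replace their action by some best response, i.e. an element of $\mathcal{A}_i$ that maximizes $U$ given the current actions of the other agents (ties are broken arbitrarily). For finite $k$, let $S_k(G)$ be the set of the joint actions $a(kn)$ over all such trajectories, and let $S_\infty(G)$ be the set of the limits $\lim_{k\to\infty}a(kn)$ over all trajectories for which this limit exists (i.e. $a(kn)$ is eventually constant in $k$). Put $$\mathrm{Eff}(G;k)=\frac{\min_{a\in S_k(G)}W(a)}{\max_{a\in\prod_i\mathcal{A}_i}W(a)},\qquad \mathrm{Eff}(\mathcal{W},\Gamma;k)=\inf_G \mathrm{Eff}(G;k),\qquad \mathrm{Eff}^*(\mathcal{W};k)=\sup_\Gamma \mathrm{Eff}(\mathcal{W},\Gamma;k)$$ for $k\in\{1,2,\dots\}\cup\{\infty\}$, where the infimum is over all games induced by $\mathcal{W}$ and $\Gamma$ (with any numbers of agents and resources), and the supremum is over all utility designs for $\mathcal{W}$. Proposition. For every $C\in[0,1]$, $$\mathrm{Eff}^*(\mathcal{W};1)=1-\frac{C}{2},\qquad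 \mathrm{Eff}^*(\mathcal{W};\infty)=1-\frac{C}{e},\qquad \mathrm{Eff}(\mathcal{W},\Gamma_{\rm id};1)=\mathrm{Eff}(\mathcal{W},\Gamma_{\rm id};\infty)=(1+C)^{-1}.$$ -/

import Mathlib

noncomputable section

namespace RoundRobin

open Filter Topology

/-- A submodular rule: `w 0 = 0`, positive at every positive number of users, non-decreasing, and
with non-increasing increments. Both the welfare rules and the distribution rules are of this
kind. -/
structure IsSubmodularRule (w : ℕ → ℝ) : Prop where
  zero : w 0 = 0
  pos : ∀ j, 1 ≤ j → 0 < w j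
  mono : Monotone w
  concave : Antitone fun j => w (j + 1) - w j

/-- The rule `w` has curvature `c`, i.e. `c = 1 - lim (w (n + 1) - w n) / w 1`. -/
def HasCurvature (w : ℕ → ℝ) (c : ℝ) : Prop :=
  ∃ l : ℝ, Tendsto (fun n => (w (n + 1) - w n) / w 1) atTop (𝓝 l) ∧ c = 1 - l

/-- The set of all submodular welfare rules of curvature at most `c`. -/
def rulesOfCurvatureAtMost (c : ℝ) : Set (ℕ → ℝ) :=
  {w | IsSubmodularRule w ∧ ∃ c' ≤ c, HasCurvature w c'}

/-- A resource allocation game: `n` agents, `d` resources, a non-empty set of actions (sets of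
resources) for each agent, and a welfare rule and a distribution rule for each resource. -/
structure Game where
  n : ℕ
  d : ℕ
  actions : Fin n → Finset (Finset (Fin d))
  actions_nonempty : ∀ i, (actions i).Nonempty
  welfareRule : Fin d → ℕ → ℝ
  distributionRule : Fin d → ℕ → ℝ

namespace Game

variable (G : Game)

/-- A choice of a set of resources by every agent. (The walk starts at the all-empty profile, which
need not consist of available actions.) -/
abbrev Profile : Type := Fin G.n → Finset (Fin G.d)

variable {G}

/-- The number `|a|_r` of agents that use the resource `r`. -/
def load (a : G.Profile) (r : Fin G.d) : ℕ :=
  (Finset.univ.filter fun i => r ∈ a i).card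

/-- The system welfare `W(a)`. -/
def welfare (a : G.Profile) : ℝ :=
  ∑ r, G.welfareRule r (load a r)

/-- The utility `U_i(a)`; it is the same sum over all resources for every agent `i`. -/
def utility (a : G.Profile) : ℝ :=
  ∑ r, G.distributionRule r (load a r)

variable (G)

/-- The joint actions, i.e. the product of the action sets. -/
def jointActions : Finset G.Profile :=
  Fintype.piFinset G.actions

theorem jointActions_nonempty : G.jointActions.Nonempty :=
  Fintype.piFinset_nonempty.2 G.actions_nonempty

/-- The optimal welfare, a maximum over the finite non-empty set of joint actions. -/
def optWelfare : ℝ :=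
  G.jointActions.sup' G.jointActions_nonempty welfare

variable {G}

/-- `s` is a best response of agent `i` to the actions in `a` of the other agents. -/
def IsBestResponse (a : G.Profile) (i : Fin G.n) (s : Finset (Fin G.d)) : Prop :=
  s ∈ G.actions i ∧
    ∀ t ∈ G.actions i, utility (Function.update a i t) ≤ utility (Function.update a i s)

/-- `x` is a trajectory of the round-robin best response process: it starts with no resource in use,
and in step `τ + 1` agent `τ mod n` (counted from `0`) moves to some best response, while the
others keep their actions. Ties may be broken in any way. -/
def IsWalk (x : ℕ → G.Profile) : Prop :=
  (x 0 = fun _ => ∅) ∧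
    ∀ (τ : ℕ) (i : Fin G.n), (i : ℕ) = τ % G.n →
      ∃ s, IsBestResponse (x τ) i s ∧ x (τ + 1) = Function.update (x τ) i s

variable (G)

/-- The possible results of the `k`-round walk. For finite `k` these are the states after `k` rounds
of some trajectory; for `k = ⊤` they are the limits, as the number of rounds tends to infinity, of
the convergent trajectories (in a finite set, convergent means eventually constant). -/
def outcomes (k : ℕ∞) : Set G.Profile :=
  {a | ∃ x : ℕ → G.Profile, IsWalk x ∧
    (∀ m : ℕ, k = m → x (m * G.n) = a) ∧
    (k = ⊤ → ∀ᶠ m : ℕ in atTop, x (m * G.n) = a)}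

/-- The efficiency of the `k`-round walk in `G`: the least welfare of a possible result, relative to
the optimal welfare. -/
def efficiency (k : ℕ∞) : ℝ :=
  sInf ((fun a : G.Profile => welfare a / G.optWelfare) '' G.outcomes k)

end Game

/-- The games induced by a set of welfare rules and a utility design. Games in which no joint action
yields any welfare, where the efficiency would be `0 / 0`, are left out. -/
def games (𝒲 : Set (ℕ → ℝ)) (Γ : (ℕ → ℝ) → ℕ → ℝ) : Set Game :=
  {G | (∀ r, G.welfareRule r ∈ 𝒲 ∧ G.distributionRule r = Γ (G.welfareRule r)) ∧
    0 < G.optWelfare}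

/-- `Γ` is a utility design for `𝒲`: it assigns to each welfare rule `w` of `𝒲` a distribution rule
that is non-decreasing and concave and agrees with `w` at `1`. (Values outside `𝒲` play no role.) -/
def IsUtilityDesign (𝒲 : Set (ℕ → ℝ)) (Γ : (ℕ → ℝ) → ℕ → ℝ) : Prop :=
  ∀ w ∈ 𝒲, IsSubmodularRule (Γ w) ∧ Γ w 1 = w 1

/-- The efficiency guarantee of the `k`-round walk under the design `Γ`. -/
def guarantee (𝒲 : Set (ℕ → ℝ)) (Γ : (ℕ → ℝ) → ℕ → ℝ) (k : ℕ∞) : ℝ :=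
  sInf ((fun G : Game => G.efficiency k) '' games 𝒲 Γ)

/-- The optimal efficiency guarantee of the `k`-round walk. -/
def optGuarantee (𝒲 : Set (ℕ → ℝ)) (k : ℕ∞) : ℝ :=
  sSup ((fun Γ => guarantee 𝒲 Γ k) '' {Γ | IsUtilityDesign 𝒲 Γ})

/-- The common-interest design, which uses the welfare rules themselves as distribution rules. -/
def commonInterest : (ℕ → ℝ) → ℕ → ℝ := id

end RoundRobin

end

/-!
The lower bounds compare, resource by resource, the number `x` of users in an outcome `a` of the
walk with the number `y` of users in an optimal joint action `b`.

*Lower bounds.* After one round the concavity of the distribution rules `F` gives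
`∑ y * (F (x + 1) - F x) ≤ U(a)`, and in a limit, where all agents play best responses, it gives
`∑ y * (F (x + 1) - F x) ≤ ∑ x * (F x - F (x - 1))`. A guarantee `ρ` follows from an inequality
between `w y`, `w x` and such terms at a single resource (`smoothness_oneRoundDesign`,
`smoothness_limitDesign`, `smoothness_commonInterest`). Curvature enters by splitting `w` into a
linear part of slope `(1 - c) * w 1` and an excess `u ≤ c * w`. The linear part loses nothing; a
good design `F` keeps it, up to the normalization at `1`, and treats the excess separately. For
one round it uses `u / 2`, which gives the ratio `1 / 2` on the excess and hence `1 - c / 2` in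
total. For the limit it uses increments that are smoothed over a binomial number of users: with
`g x = ∫₀¹ exp (p - 1) * 𝔼 [u (B + 1) - u B] dp`, `B` binomial with `x` trials of success
probability `p`, integration by parts and concavity yield
`(1 - 1 / e) * u y ≤ u x + y * g x - x * g (x - 1)`, hence `1 - c / e` in total. Under the common
interest design the utility is the welfare, so the bound for one round persists in the limit.
Limits exist because, after the first round, a walk that prefers to stay put strictly increases
the utility with each move, and there are only finitely many profiles.

*Upper bounds.* All games are built from `coverRule`, and every agent `i` chooses between `a i`
and `b i`. For one round two agents suffice. For the common interest design each agent of a long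
chain is indifferent between a private resource and the one of its predecessor together with a
resource of value `c`. For the limit under an arbitrary design the resources are the lists of
distinct agents among `n`; agent `i` uses either the lists that avoid `i` or those with head `i`.
Prepending `i` is a bijection between the two that does not change the load caused by others, so
all agents are always indifferent, whatever the design (`sum_avoiding_eq_sum_headed`). There are
`n! / k!` lists with load `k` in the outcome `a`, so that the loads are asymptotically Poisson of
mean `1`, while every non-empty list has load `1` under `b`; the ratio of the welfares tends to
`1 - c / e`.
-/

noncomputable section

namespace RoundRobin

open Filter Topology

/-! ### Concave rules and curvature -/

theorem le_add_mul_increment {u : ℕ → ℝ} (hu : Antitone fun j => u (j + 1) - u j) (x y : ℕ) :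
    u (x + y) ≤ u x + y * (u (x + 1) - u x) := by
  induction y with
  | zero => simp
  | succ y ih =>
    have h : u (x + y + 1) - u (x + y) ≤ u (x + 1) - u x := hu (Nat.le_add_right x y)
    rw [← add_assoc]
    push_cast
    linarith

theorem increment_ge_of_mem {c : ℝ} {w : ℕ → ℝ} (hw : w ∈ rulesOfCurvatureAtMost c) (j : ℕ) :
    (1 - c) * w 1 ≤ w (j + 1) - w j := by
  obtain ⟨hs, c', hc', l, hl, rfl⟩ := hw
  have hpos := hs.pos 1 le_rfl
  have hanti : Antitone fun n => (w (n + 1) - w n) / w 1 := fun m n h =>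
    div_le_div_of_nonneg_right (hs.concave h) hpos.le
  have h := hanti.le_of_tendsto hl j
  rw [le_div_iff₀ hpos] at h
  nlinarith

/-- The part of a rule that exceeds its linear part of slope `(1 - c) * w 1`. -/
def excess (c : ℝ) (w : ℕ → ℝ) (j : ℕ) : ℝ :=
  w j - (1 - c) * w 1 * j

section excess

variable {c : ℝ} {w : ℕ → ℝ}

theorem excess_zero (hw : w ∈ rulesOfCurvatureAtMost c) : excess c w 0 = 0 := by
  simp [excess, hw.1.zero]

theorem excess_one : excess c w 1 = c * w 1 := by
  simp only [excess, Nat.cast_one]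
  ring

theorem excess_succ_sub (j : ℕ) :
    excess c w (j + 1) - excess c w j = w (j + 1) - w j - (1 - c) * w 1 := by
  simp only [excess]
  push_cast
  ring

theorem excess_monotone (hw : w ∈ rulesOfCurvatureAtMost c) : Monotone (excess c w) :=
  monotone_nat_of_le_succ fun j => by
    linarith [excess_succ_sub (c := c) (w := w) j, increment_ge_of_mem hw j]

theorem excess_concave (hw : w ∈ rulesOfCurvatureAtMost c) :
    Antitone fun j => excess c w (j + 1) - excess c w j := by
  intro i j h
  have := hw.1.concave h
  simp only [excess_succ_sub] at this ⊢
  linarith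

theorem excess_le (hc₁ : c ≤ 1) (hw : w ∈ rulesOfCurvatureAtMost c) (j : ℕ) :
    excess c w j ≤ c * w j := by
  have h := le_add_mul_increment hw.1.concave 0 j
  simp only [zero_add, hw.1.zero, sub_zero] at h
  simp only [excess]
  nlinarith [mul_le_mul_of_nonneg_left h (sub_nonneg.2 hc₁)]

end excess

/-- The rule that mixes set covering (weight `c`) with a linear rule (weight `1 - c`). Among the
rules of curvature at most `c` with value `1` at `1`, it is the smallest. -/
def coverRule (c : ℝ) (j : ℕ) : ℝ :=
  c * min (j : ℝ) 1 + (1 - c) * j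

@[simp] theorem coverRule_zero (c : ℝ) : coverRule c 0 = 0 := by
  simp [coverRule]

theorem coverRule_succ (c : ℝ) (j : ℕ) : coverRule c (j + 1) = 1 + (1 - c) * j := by
  have : min ((j + 1 : ℕ) : ℝ) 1 = 1 :=
    min_eq_right (by push_cast; linarith [j.cast_nonneg (α := ℝ)])
  rw [coverRule, this]
  push_cast
  ring

@[simp] theorem coverRule_one (c : ℝ) : coverRule c 1 = 1 := by
  simpa using coverRule_succ c 0

@[simp] theorem coverRule_two (c : ℝ) : coverRule c 2 = 2 - c := by
  have := coverRule_succ c 1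
  norm_num at this
  linarith

theorem coverRule_succ_sub (c : ℝ) (j : ℕ) :
    coverRule c (j + 1) - coverRule c j = if j = 0 then 1 else 1 - c := by
  rcases j with _ | j
  · simp
  · rw [coverRule_succ, coverRule_succ, if_neg j.succ_ne_zero]
    push_cast
    ring

theorem mul_coverRule_mem {c v : ℝ} (hc₀ : 0 ≤ c) (hc₁ : c ≤ 1) (hv : 0 < v) :
    (fun j => v * coverRule c j) ∈ rulesOfCurvatureAtMost c := by
  have hinc (j : ℕ) : v * coverRule c (j + 1) - v * coverRule c j
      = if j = 0 then v else v * (1 - c) := by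
    rw [← mul_sub, coverRule_succ_sub]
    split_ifs <;> simp
  refine ⟨⟨by simp, fun j hj => ?_, monotone_nat_of_le_succ fun j => ?_, fun i j hij => ?_⟩,
    c, le_rfl, 1 - c, ?_, by ring⟩
  · obtain ⟨j, rfl⟩ := Nat.exists_eq_add_of_le' hj
    rw [coverRule_succ]
    have : 0 ≤ (1 - c) * j := mul_nonneg (sub_nonneg.2 hc₁) j.cast_nonneg
    positivity
  · rw [← sub_nonneg, hinc]
    split_ifs
    · exact hv.le
    · exact mul_nonneg hv.le (sub_nonneg.2 hc₁)
  · simp only [hinc]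
    rcases Nat.eq_zero_or_pos i with rfl | hi
    · by_cases hj : j = 0
      · rw [hj]
      · rw [if_neg hj, if_pos rfl]
        nlinarith
    · rw [if_neg hi.ne', if_neg (hi.trans_le hij).ne']
  · refine tendsto_const_nhds.congr' ?_
    filter_upwards [eventually_ne_atTop 0] with j hj
    rw [hinc, if_neg hj, coverRule_one]
    field_simp

theorem coverRule_mem {c : ℝ} (hc₀ : 0 ≤ c) (hc₁ : c ≤ 1) :
    coverRule c ∈ rulesOfCurvatureAtMost c := by
  simpa using mul_coverRule_mem hc₀ hc₁ one_pos

/-! ### Binomial smoothing -/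

/-- The mean of `u` under the binomial distribution with `x` trials of success probability `p`,
defined by conditioning on the first trial. -/
def binomialMean : ℕ → (ℕ → ℝ) → ℝ → ℝ
  | 0, u, _ => u 0
  | x + 1, u, p => (1 - p) * binomialMean x u p + p * binomialMean x (fun j => u (j + 1)) p

theorem binomialMean_const (x : ℕ) (v p : ℝ) : binomialMean x (fun _ => v) p = v := by
  induction x with
  | zero => rfl
  | succ x ih =>
    simp only [binomialMean, ih]
    ring

theorem binomialMean_linear (x : ℕ) (u v : ℕ → ℝ) (s p : ℝ) :
    binomialMean x (fun j => u j + s * v j) p = binomialMean x u p + s * binomialMean x v p := by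
  induction x generalizing u v with
  | zero => rfl
  | succ x ih =>
    simp only [binomialMean]
    rw [ih u v, ih (fun j => u (j + 1)) (fun j => v (j + 1))]
    ring

theorem binomialMean_le {u v : ℕ → ℝ} (h : ∀ j, u j ≤ v j) (x : ℕ) {p : ℝ} (hp₀ : 0 ≤ p)
    (hp₁ : p ≤ 1) : binomialMean x u p ≤ binomialMean x v p := by
  induction x generalizing u v with
  | zero => exact h 0
  | succ x ih =>
    exact add_le_add (mul_le_mul_of_nonneg_left (ih h) (sub_nonneg.2 hp₁))
      (mul_le_mul_of_nonneg_left (ih fun j => h (j + 1)) hp₀)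

theorem binomialMean_at_zero (x : ℕ) (u : ℕ → ℝ) : binomialMean x u 0 = u 0 := by
  induction x generalizing u with
  | zero => rfl
  | succ x ih => simp [binomialMean, ih]

theorem binomialMean_at_one (x : ℕ) (u : ℕ → ℝ) : binomialMean x u 1 = u x := by
  induction x generalizing u with
  | zero => rfl
  | succ x ih => simp [binomialMean, ih]

theorem hasDerivAt_binomialMean_succ (x : ℕ) (u : ℕ → ℝ) (p : ℝ) :
    HasDerivAt (binomialMean (x + 1) u)
      ((x + 1) * binomialMean x (fun j => u (j + 1) - u j) p) p := by
  induction x generalizing u with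
  | zero =>
    have h := (((hasDerivAt_id p).const_sub 1).mul_const (u 0)).add
      ((hasDerivAt_id p).mul_const (u 1))
    refine h.congr_deriv ?_
    simp [binomialMean]
    ring
  | succ x ih =>
    have h := (((hasDerivAt_id p).const_sub 1).mul (ih u)).add
      ((hasDerivAt_id p).mul (ih fun j => u (j + 1)))
    refine h.congr_deriv ?_
    have hlin := binomialMean_linear (x + 1) (fun j => u (j + 1)) u (-1) p
    have hfun : (fun j => u (j + 1) + -1 * u j) = fun j => u (j + 1) - u j := by
      funext j
      ring
    rw [hfun] at hlin
    have hstep : binomialMean (x + 1) (fun j => u (j + 1) - u j) p =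
      (1 - p) * binomialMean x (fun j => u (j + 1) - u j) p
        + p * binomialMean x (fun j => u (j + 1 + 1) - u (j + 1)) p := rfl
    simp only [id]
    push_cast
    linear_combination (-(x : ℝ) - 1) * hstep - hlin

theorem continuous_binomialMean (x : ℕ) (u : ℕ → ℝ) : Continuous (binomialMean x u) := by
  rcases x with _ | x
  · exact continuous_const
  · exact continuous_iff_continuousAt.2 fun p => (hasDerivAt_binomialMean_succ x u p).continuousAt

/-- The mean of `u` at a binomial number of users out of `x`, where the participation probability
`p` has density `exp (p - 1)` on `[0, 1]` (of total mass `1 - 1 / e`). -/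
def smoothed (u : ℕ → ℝ) (x : ℕ) : ℝ :=
  ∫ p in (0 : ℝ)..1, Real.exp (p - 1) * binomialMean x u p

theorem intervalIntegrable_smoothed (u : ℕ → ℝ) (x : ℕ) :
    IntervalIntegrable (fun p => Real.exp (p - 1) * binomialMean x u p) MeasureTheory.volume 0 1 :=
  ((by fun_prop : Continuous fun p : ℝ => Real.exp (p - 1)).mul
    (continuous_binomialMean x u)).intervalIntegrable _ _

theorem smoothed_linear (u v : ℕ → ℝ) (s : ℝ) (x : ℕ) :
    smoothed (fun j => u j + s * v j) x = smoothed u x + s * smoothed v x := by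
  simp only [smoothed]
  rw [← intervalIntegral.integral_const_mul, ← intervalIntegral.integral_add
    (intervalIntegrable_smoothed u x) ((intervalIntegrable_smoothed v x).const_mul s)]
  refine intervalIntegral.integral_congr fun p _ => ?_
  simp only [binomialMean_linear]
  ring

theorem smoothed_le {u v : ℕ → ℝ} {x y : ℕ}
    (h : ∀ p : ℝ, 0 ≤ p → p ≤ 1 → binomialMean x u p ≤ binomialMean y v p) :
    smoothed u x ≤ smoothed v y :=
  intervalIntegral.integral_mono_on zero_le_one (intervalIntegrable_smoothed u x)
    (intervalIntegrable_smoothed v y) fun p hp =>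
      mul_le_mul_of_nonneg_left (h p hp.1 hp.2) (Real.exp_pos _).le

theorem smoothed_const (v : ℝ) (x : ℕ) :
    smoothed (fun _ => v) x = (1 - 1 / Real.exp 1) * v := by
  have h (p : ℝ) : HasDerivAt (fun p : ℝ => Real.exp (p - 1)) (Real.exp (p - 1)) p := by
    simpa using ((hasDerivAt_id p).sub_const 1).exp
  simp only [smoothed, binomialMean_const, intervalIntegral.integral_mul_const]
  rw [intervalIntegral.integral_eq_sub_of_hasDerivAt (fun p _ => h p)
    ((by fun_prop : Continuous fun p : ℝ => Real.exp (p - 1)).intervalIntegrable _ _)]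
  simp [Real.exp_neg]

/-- Integration by parts: the derivative of the binomial mean in `p` is the mean increment, and the
density is its own derivative. -/
theorem succ_mul_smoothed_increment {u : ℕ → ℝ} (hu : u 0 = 0) (x : ℕ) :
    (x + 1) * smoothed (fun j => u (j + 1) - u j) x = u (x + 1) - smoothed u (x + 1) := by
  have hexp (p : ℝ) : HasDerivAt (fun p : ℝ => Real.exp (p - 1)) (Real.exp (p - 1)) p := by
    simpa using ((hasDerivAt_id p).sub_const 1).exp
  have hint : IntervalIntegrable (fun p => Real.exp (p - 1) *
      ((x + 1) * binomialMean x (fun j => u (j + 1) - u j) p)) MeasureTheory.volume 0 1 :=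
    ((by fun_prop : Continuous fun p : ℝ => Real.exp (p - 1)).mul
      (continuous_const.mul (continuous_binomialMean x _))).intervalIntegrable _ _
  have h := intervalIntegral.integral_eq_sub_of_hasDerivAt (a := 0) (b := 1)
    (fun p _ => (hexp p).mul (hasDerivAt_binomialMean_succ x u p))
    ((intervalIntegrable_smoothed u (x + 1)).add hint)
  rw [intervalIntegral.integral_add (intervalIntegrable_smoothed u (x + 1)) hint] at h
  simp only [Pi.mul_apply, binomialMean_at_one, binomialMean_at_zero, hu, sub_self, Real.exp_zero,
    one_mul, mul_zero, sub_zero] at h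
  have h2 : ∫ p in (0 : ℝ)..1, Real.exp (p - 1) *
      ((x + 1) * binomialMean x (fun j => u (j + 1) - u j) p)
      = (x + 1) * smoothed (fun j => u (j + 1) - u j) x := by
    rw [smoothed, ← intervalIntegral.integral_const_mul]
    refine intervalIntegral.integral_congr fun p _ => ?_
    ring
  rw [h2] at h
  simp only [smoothed] at h ⊢
  linarith

theorem smoothed_increment_antitone {u : ℕ → ℝ} (hconc : Antitone fun j => u (j + 1) - u j) :
    Antitone (smoothed fun j => u (j + 1) - u j) := by
  refine antitone_nat_of_succ_le fun x => smoothed_le fun p hp₀ hp₁ => ?_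
  have h := binomialMean_le (fun j => hconc (Nat.le_succ j)) x hp₀ hp₁
  calc _ ≤ (1 - p) * binomialMean x (fun j => u (j + 1) - u j) p
          + p * binomialMean x (fun j => u (j + 1) - u j) p :=
        add_le_add le_rfl (mul_le_mul_of_nonneg_left h hp₀)
    _ = _ := by ring

theorem smoothed_increment_nonneg {u : ℕ → ℝ} (hmono : Monotone u) (x : ℕ) :
    0 ≤ smoothed (fun j => u (j + 1) - u j) x := by
  have h : smoothed (fun _ => 0) x ≤ smoothed (fun j => u (j + 1) - u j) x :=
    smoothed_le fun p hp₀ hp₁ =>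
      binomialMean_le (fun j => sub_nonneg.2 (hmono (Nat.le_succ j))) x hp₀ hp₁
  rwa [smoothed_const, mul_zero] at h

/-- Joining `x` random users with `y` further ones yields at least `u y`; by concavity, so do `y`
copies of the increment at the random users. -/
theorem le_mul_smoothed_increment {u : ℕ → ℝ} (hmono : Monotone u)
    (hconc : Antitone fun j => u (j + 1) - u j) (x y : ℕ) :
    (1 - 1 / Real.exp 1) * u y
      ≤ smoothed u x + y * smoothed (fun j => u (j + 1) - u j) x := by
  rw [← smoothed_linear, ← smoothed_const _ x]
  exact smoothed_le fun p hp₀ hp₁ => binomialMean_le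
    (fun j => (hmono (Nat.le_add_left y j)).trans (le_add_mul_increment hconc j y)) x hp₀ hp₁

/-- The comparison of a resource with `x` users in equilibrium and `y` users in the optimum. For
`x = 0` the last term vanishes, whatever the value at the truncated `x - 1`. -/
theorem smoothness_smoothed {u : ℕ → ℝ} (hu : u 0 = 0) (hmono : Monotone u)
    (hconc : Antitone fun j => u (j + 1) - u j) (x y : ℕ) :
    (1 - 1 / Real.exp 1) * u y ≤ u x + y * smoothed (fun j => u (j + 1) - u j) x
      - x * smoothed (fun j => u (j + 1) - u j) (x - 1) := by
  have h := le_mul_smoothed_increment hmono hconc x y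
  rcases x with _ | x
  · have h0 : smoothed u 0 = 0 := by
      simp [smoothed, binomialMean, hu]
    rw [h0] at h
    simpa only [hu, zero_add, Nat.cast_zero, zero_mul, sub_zero] using h
  · have h2 := succ_mul_smoothed_increment hu x
    simp only [Nat.add_sub_cancel]
    push_cast
    linarith

/-! ### The optimal designs -/

/-- The design that is optimal for one round. -/
def oneRoundDesign (c : ℝ) (w : ℕ → ℝ) (j : ℕ) : ℝ :=
  (w j + (1 - c) * w 1 * j) / (2 - c)

/-- The design that is optimal in the limit. Its increments combine the linear part of `w` with the
smoothed increments of the excess. -/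
def limitDesign (c : ℝ) (w : ℕ → ℝ) (j : ℕ) : ℝ :=
  (∑ i ∈ Finset.range j, ((1 - c) * w 1
    + smoothed (fun j => excess c w (j + 1) - excess c w j) i)) / (1 - c / Real.exp 1)

theorem one_sub_div_exp_pos {c : ℝ} (hc₁ : c ≤ 1) : 0 < 1 - c / Real.exp 1 := by
  have h : 1 < Real.exp 1 := Real.one_lt_exp_iff.2 one_pos
  rw [sub_pos, div_lt_one (Real.exp_pos 1)]
  exact hc₁.trans_lt h

theorem isSubmodularRule_of_increments {F : ℕ → ℝ} (h0 : F 0 = 0) (h1 : 0 < F 1)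
    (hmono : ∀ j, F j ≤ F (j + 1)) (hconc : Antitone fun j => F (j + 1) - F j) :
    IsSubmodularRule F :=
  ⟨h0, fun _ hj => h1.trans_le (monotone_nat_of_le_succ hmono hj), monotone_nat_of_le_succ hmono,
    hconc⟩

theorem isUtilityDesign_commonInterest (c : ℝ) :
    IsUtilityDesign (rulesOfCurvatureAtMost c) commonInterest :=
  fun _ hw => ⟨hw.1, rfl⟩

theorem isUtilityDesign_oneRoundDesign {c : ℝ} (hc₁ : c ≤ 1) :
    IsUtilityDesign (rulesOfCurvatureAtMost c) (oneRoundDesign c) := by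
  intro w hw
  have hpos : 0 < 2 - c := by linarith
  have h1 : oneRoundDesign c w 1 = w 1 := by
    simp only [oneRoundDesign, Nat.cast_one]
    field_simp
    ring
  have hinc (j : ℕ) : oneRoundDesign c w (j + 1) - oneRoundDesign c w j
      = (w (j + 1) - w j + (1 - c) * w 1) / (2 - c) := by
    simp only [oneRoundDesign]
    push_cast
    ring
  have hw1 := hw.1.pos 1 le_rfl
  refine ⟨isSubmodularRule_of_increments (by simp [oneRoundDesign, hw.1.zero]) (h1 ▸ hw1)
    (fun j => ?_) fun i j hij => ?_, h1⟩
  · rw [← sub_nonneg, hinc]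
    have := hw.1.mono (Nat.le_succ j)
    have : 0 ≤ (1 - c) * w 1 := mul_nonneg (sub_nonneg.2 hc₁) hw1.le
    exact div_nonneg (by simp only [Nat.succ_eq_add_one] at *; linarith) hpos.le
  · simp only [hinc]
    exact div_le_div_of_nonneg_right (add_le_add_left (hw.1.concave hij) _) hpos.le

theorem limitDesign_succ_sub (c : ℝ) (w : ℕ → ℝ) (j : ℕ) :
    limitDesign c w (j + 1) - limitDesign c w j
      = ((1 - c) * w 1 + smoothed (fun j => excess c w (j + 1) - excess c w j) j)
        / (1 - c / Real.exp 1) := by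
  rw [limitDesign, limitDesign, ← sub_div, Finset.sum_range_succ_sub_sum]

theorem isUtilityDesign_limitDesign {c : ℝ} (hc₁ : c ≤ 1) :
    IsUtilityDesign (rulesOfCurvatureAtMost c) (limitDesign c) := by
  intro w hw
  have hpos := one_sub_div_exp_pos hc₁
  have hw1 := hw.1.pos 1 le_rfl
  have h0 : limitDesign c w 0 = 0 := by simp [limitDesign]
  have h1 : limitDesign c w 1 = w 1 := by
    have h := limitDesign_succ_sub c w 0
    have hs : smoothed (fun j => excess c w (j + 1) - excess c w j) 0
        = (1 - 1 / Real.exp 1) * (c * w 1) := by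
      rw [← smoothed_const _ 0]
      simp only [smoothed, binomialMean, zero_add, excess_zero hw, excess_one, sub_zero]
    rw [zero_add, h0, sub_zero, hs] at h
    rw [h, div_eq_iff hpos.ne']
    ring
  refine ⟨isSubmodularRule_of_increments h0 (h1 ▸ hw1) (fun j => ?_) fun i j hij => ?_, h1⟩
  · rw [← sub_nonneg, limitDesign_succ_sub]
    exact div_nonneg (add_nonneg (mul_nonneg (sub_nonneg.2 hc₁) hw1.le)
      (smoothed_increment_nonneg (excess_monotone hw) j)) hpos.le
  · simp only [limitDesign_succ_sub]
    exact div_le_div_of_nonneg_right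
      (add_le_add_right (smoothed_increment_antitone (excess_concave hw) hij) _) hpos.le

/-- The comparison of a resource with `x` users after one round and `y` users in the optimum, under
the design that is optimal for one round. -/
theorem smoothness_oneRoundDesign {c : ℝ} (hc₁ : c ≤ 1) {w : ℕ → ℝ}
    (hw : w ∈ rulesOfCurvatureAtMost c) (x y : ℕ) :
    (1 - c / 2) * w y ≤ w x + (1 - c / 2) *
      (y * (oneRoundDesign c w (x + 1) - oneRoundDesign c w x) - oneRoundDesign c w x) := by
  have hpos : 0 < 2 - c := by linarith
  have h1 := le_add_mul_increment (excess_concave hw) x y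
  have h2 := excess_monotone hw (Nat.le_add_left y x)
  have h3 := excess_le hc₁ hw y
  have hD (j : ℕ) : (1 - c / 2) * oneRoundDesign c w j = (w j + (1 - c) * w 1 * j) / 2 := by
    rw [oneRoundDesign]
    field_simp
  rw [mul_sub, mul_left_comm, mul_sub (1 - c / 2) (oneRoundDesign c w (x + 1)), hD, hD]
  simp only [excess] at h1 h2 h3
  push_cast at h1 h2 h3 ⊢
  linarith

/-- The comparison of a resource with `x` users in equilibrium and `y` users in the optimum, under
the design that is optimal in the limit. -/
theorem smoothness_limitDesign {c : ℝ} (hc₁ : c ≤ 1) {w : ℕ → ℝ}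
    (hw : w ∈ rulesOfCurvatureAtMost c) (x y : ℕ) :
    (1 - c / Real.exp 1) * w y ≤ w x + (1 - c / Real.exp 1) *
      (y * (limitDesign c w (x + 1) - limitDesign c w x)
        - x * (limitDesign c w (x - 1 + 1) - limitDesign c w (x - 1))) := by
  have hpos := one_sub_div_exp_pos hc₁
  have h1 := smoothness_smoothed (excess_zero hw) (excess_monotone hw) (excess_concave hw) x y
  have h2 := mul_le_mul_of_nonneg_left (excess_le hc₁ hw y) (one_div_pos.2 (Real.exp_pos 1)).le
  have hD (j : ℕ) : (1 - c / Real.exp 1) * (limitDesign c w (j + 1) - limitDesign c w j)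
      = (1 - c) * w 1 + smoothed (fun j => excess c w (j + 1) - excess c w j) j := by
    rw [limitDesign_succ_sub, mul_div_cancel₀ _ hpos.ne']
  rw [mul_sub, mul_left_comm, hD, mul_left_comm, hD]
  have hx : w x = excess c w x + (1 - c) * w 1 * x := by
    simp only [excess]
    ring
  have hy : w y = excess c w y + (1 - c) * w 1 * y := by
    simp only [excess]
    ring
  have h3 : (1 - c / Real.exp 1) * w y = w y - 1 / Real.exp 1 * (c * w y) := by ring
  have h4 : w y - 1 / Real.exp 1 * excess c w y
    = (1 - 1 / Real.exp 1) * excess c w y + (1 - c) * w 1 * y := by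
    rw [hy]
    ring
  rw [h3, hx]
  linarith

/-- The comparison of a resource with `x` users after one round and `y` users in the optimum, under
the common-interest design. -/
theorem smoothness_commonInterest {c : ℝ} (hc₁ : c ≤ 1) {w : ℕ → ℝ}
    (hw : w ∈ rulesOfCurvatureAtMost c) (x y : ℕ) :
    w y ≤ c * w x + y * (w (x + 1) - w x) := by
  have h1 := le_add_mul_increment hw.1.concave x y
  have h2 := excess_monotone hw (Nat.le_add_left y x)
  have h3 := excess_le hc₁ hw x
  simp only [excess] at h2 h3
  push_cast at h2
  linarith

/-! ### Best responses -/

namespace Game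

variable {G : Game}

/-- The number of agents other than `i` that use the resource `r`. -/
def othersLoad (p : G.Profile) (i : Fin G.n) (r : Fin G.d) : ℕ :=
  (Finset.univ.filter fun j => j ≠ i ∧ r ∈ p j).card

/-- The utility that agent `i` adds with the action `t`, given the actions of the others. -/
def gain (p : G.Profile) (i : Fin G.n) (t : Finset (Fin G.d)) : ℝ :=
  ∑ r ∈ t, (G.distributionRule r (othersLoad p i r + 1) - G.distributionRule r (othersLoad p i r))

theorem load_update (p : G.Profile) (i : Fin G.n) (t : Finset (Fin G.d)) (r : Fin G.d) :
    load (Function.update p i t) r = othersLoad p i r + if r ∈ t then 1 else 0 := by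
  have h : (Finset.univ.filter fun j => r ∈ Function.update p i t j)
      = (Finset.univ.filter fun j => j ≠ i ∧ r ∈ p j) ∪ (if r ∈ t then {i} else ∅) := by
    ext j
    rcases eq_or_ne j i with rfl | hj
    · by_cases hr : r ∈ t <;> simp [hr]
    · by_cases hr : r ∈ t <;> simp [hr, hj]
  rw [load, h, Finset.card_union_of_disjoint]
  · split_ifs <;> simp [othersLoad]
  · split_ifs <;> simp

theorem load_eq_othersLoad (p : G.Profile) (i : Fin G.n) (r : Fin G.d) :
    load p r = othersLoad p i r + if r ∈ p i then 1 else 0 := by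
  conv_lhs => rw [← Function.update_eq_self i p]
  exact load_update p i (p i) r

theorem othersLoad_le (p : G.Profile) (i : Fin G.n) (r : Fin G.d) :
    othersLoad p i r ≤ load p r := by
  rw [load_eq_othersLoad p i r]
  exact Nat.le_add_right _ _

theorem utility_update (p : G.Profile) (i : Fin G.n) (t : Finset (Fin G.d)) :
    utility (Function.update p i t)
      = ∑ r, G.distributionRule r (othersLoad p i r) + gain p i t := by
  have h : gain p i t = ∑ r, if r ∈ t then
      (G.distributionRule r (othersLoad p i r + 1) - G.distributionRule r (othersLoad p i r))
      else 0 := by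
    rw [← Finset.sum_filter]
    simp [gain]
  rw [h, ← Finset.sum_add_distrib]
  refine Finset.sum_congr rfl fun r _ => ?_
  rw [load_update]
  split_ifs <;> simp

theorem isBestResponse_iff {p : G.Profile} {i : Fin G.n} {s : Finset (Fin G.d)} :
    IsBestResponse p i s ↔ s ∈ G.actions i ∧ ∀ t ∈ G.actions i, gain p i t ≤ gain p i s := by
  simp only [IsBestResponse, utility_update, add_le_add_iff_left]

theorem exists_isBestResponse (p : G.Profile) (i : Fin G.n) : ∃ s, IsBestResponse p i s :=
  Finset.exists_max_image (G.actions i) (fun t => utility (Function.update p i t))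
    (G.actions_nonempty i)

theorem sum_sum_mem (a : G.Profile) (f : Fin G.d → ℝ) :
    ∑ i, ∑ r ∈ a i, f r = ∑ r, load a r * f r := by
  calc _ = ∑ i, ∑ r, if r ∈ a i then f r else 0 := by simp
    _ = ∑ r, ∑ i, if r ∈ a i then f r else 0 := Finset.sum_comm
    _ = _ := by simp [load, Finset.sum_ite]

/-! ### Round-robin trajectories -/

/-- A trajectory exists, and it may follow a given preference whenever this is a best response. -/
theorem exists_isWalk (pref : G.Profile → Fin G.n → Finset (Fin G.d)) :
    ∃ x : ℕ → G.Profile, IsWalk x ∧ ∀ (τ : ℕ) (i : Fin G.n), (i : ℕ) = τ % G.n →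
      IsBestResponse (x τ) i (pref (x τ) i) →
        x (τ + 1) = Function.update (x τ) i (pref (x τ) i) := by
  have hex (p : G.Profile) (i : Fin G.n) :
      ∃ s, IsBestResponse p i s ∧ (IsBestResponse p i (pref p i) → s = pref p i) := by
    by_cases h : IsBestResponse p i (pref p i)
    · exact ⟨_, h, fun _ => rfl⟩
    · obtain ⟨s, hs⟩ := exists_isBestResponse p i
      exact ⟨s, hs, fun h' => absurd h' h⟩
  choose br hbr hpref using hex
  let x : ℕ → G.Profile := fun τ => Nat.rec (fun _ => ∅) (fun τ p =>
    if h : 0 < G.n then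
      Function.update p ⟨τ % G.n, Nat.mod_lt τ h⟩ (br p ⟨τ % G.n, Nat.mod_lt τ h⟩) else p) τ
  have hstep (τ : ℕ) (i : Fin G.n) (hi : (i : ℕ) = τ % G.n) :
      x (τ + 1) = Function.update (x τ) i (br (x τ) i) := by
    have hn : 0 < G.n := i.pos
    have : (⟨τ % G.n, Nat.mod_lt τ hn⟩ : Fin G.n) = i := Fin.ext hi.symm
    change (if h : 0 < G.n then _ else _) = _
    rw [dif_pos hn, this]
  refine ⟨x, ⟨rfl, fun τ i hi => ⟨_, hbr (x τ) i, hstep τ i hi⟩⟩, fun τ i hi h => ?_⟩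
  rw [hstep τ i hi, hpref _ _ h]

theorem IsWalk.step {x : ℕ → G.Profile} (hx : IsWalk x) (m : ℕ) (i : Fin G.n) :
    ∃ s, IsBestResponse (x (m * G.n + i)) i s ∧
      x (m * G.n + i + 1) = Function.update (x (m * G.n + i)) i s := by
  refine hx.2 _ i ?_
  rw [Nat.add_comm, Nat.add_mul_mod_self_right, Nat.mod_eq_of_lt i.2]

/-- Within a round, every agent moves once: before its turn it still plays the action from the
beginning of the round, and afterwards the one from the end of the round. -/
theorem IsWalk.within_round {x : ℕ → G.Profile} (hx : IsWalk x) (m i : ℕ) (hi : i ≤ G.n)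
    (j : Fin G.n) :
    x (m * G.n + i) j = if (j : ℕ) < i then x ((m + 1) * G.n) j else x (m * G.n) j := by
  have hother (k : ℕ) (hk : k < G.n) (hkj : (j : ℕ) ≠ k) :
      x (m * G.n + k + 1) j = x (m * G.n + k) j := by
    obtain ⟨s, -, hs⟩ := hx.step m ⟨k, hk⟩
    simp only at hs
    rw [hs, Function.update_of_ne (fun h => hkj (congrArg Fin.val h))]
  have hbefore (k : ℕ) (hk : k ≤ j) : x (m * G.n + k) j = x (m * G.n) j := by
    induction k with
    | zero => rfl
    | succ k ih => rw [← ih (by omega), ← hother k (by omega) (by omega), add_assoc]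
  have hafter (k : ℕ) (hk : (j : ℕ) + 1 ≤ k) (hkn : k ≤ G.n) :
      x (m * G.n + k) j = x (m * G.n + (j + 1)) j := by
    induction k, hk using Nat.le_induction with
    | base => rfl
    | succ k hk ih => rw [← ih (by omega), ← hother k (by omega) (by omega), add_assoc]
  split_ifs with h
  · rw [hafter i h hi, add_mul, one_mul, hafter G.n (by omega) le_rfl]
  · exact hbefore i (by omega)

theorem IsWalk.end_mem {x : ℕ → G.Profile} (hx : IsWalk x) (m : ℕ) (i : Fin G.n) :
    IsBestResponse (x (m * G.n + i)) i (x ((m + 1) * G.n) i) ∧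
      x (m * G.n + i + 1) = Function.update (x (m * G.n + i)) i (x ((m + 1) * G.n) i) := by
  obtain ⟨s, hs, hxs⟩ := hx.step m i
  have h := hx.within_round m (i + 1) i.2 i
  rw [if_pos (Nat.lt_succ_self _), ← add_assoc, hxs, Function.update_self] at h
  rw [← h]
  exact ⟨hs, hxs⟩

theorem IsWalk.mem_actions {x : ℕ → G.Profile} (hx : IsWalk x) {τ : ℕ} (hτ : G.n ≤ τ)
    (i : Fin G.n) : x τ i ∈ G.actions i := by
  have hn : 0 < G.n := i.pos
  have hmem (m : ℕ) : x ((m + 1) * G.n) i ∈ G.actions i := (hx.end_mem m i).1.1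
  obtain ⟨m, hm⟩ : ∃ m, τ / G.n = m + 1 :=
    Nat.exists_eq_add_of_le' ((Nat.one_le_div_iff hn).2 hτ)
  have h := hx.within_round (m + 1) (τ % G.n) (Nat.mod_lt τ hn).le i
  rw [← hm, Nat.div_add_mod'] at h
  rw [h, hm]
  split_ifs
  · exact hmem _
  · exact hmem _

theorem IsWalk.utility_le_succ {x : ℕ → G.Profile} (hx : IsWalk x) {τ : ℕ} (hn : 0 < G.n)
    (hτ : G.n ≤ τ) : utility (x τ) ≤ utility (x (τ + 1)) := by
  obtain ⟨s, hs, hxs⟩ := hx.2 τ ⟨τ % G.n, Nat.mod_lt τ hn⟩ rfl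
  rw [hxs]
  simpa using hs.2 _ (hx.mem_actions hτ _)

theorem IsWalk.utility_mono {x : ℕ → G.Profile} (hx : IsWalk x) (hn : 0 < G.n) {σ τ : ℕ}
    (hσ : G.n ≤ σ) (h : σ ≤ τ) : utility (x σ) ≤ utility (x τ) := by
  induction τ, h using Nat.le_induction with
  | base => exact le_rfl
  | succ τ h ih => exact ih.trans (hx.utility_le_succ hn (hσ.trans h))

/-- If every agent keeps its action whenever this is a best response, then after the first
round a move means a strict increase of the utility, which can happen only finitely often. -/
theorem exists_eventually_const (hn : 0 < G.n) :
    ∃ x : ℕ → G.Profile, IsWalk x ∧ ∃ a, ∀ᶠ τ in atTop, x τ = a := by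
  obtain ⟨x, hx, hlazy⟩ := exists_isWalk (G := G) fun p i => p i
  obtain ⟨p, ⟨σ, hσ, rfl⟩, hmax⟩ := Set.exists_max_image (x '' Set.Ici G.n) utility
    (Set.toFinite _) ⟨_, G.n, Set.mem_Ici.2 le_rfl, rfl⟩
  refine ⟨x, hx, x σ, eventually_atTop.2 ⟨σ, fun τ hτ => ?_⟩⟩
  induction τ, hτ using Nat.le_induction with
  | base => rfl
  | succ τ h ih =>
    have hτ : G.n ≤ τ := le_trans hσ h
    rw [← ih]
    let i : Fin G.n := ⟨τ % G.n, Nat.mod_lt τ hn⟩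
    obtain ⟨s, hs, hxs⟩ := hx.2 τ i rfl
    have hle := hmax (x (τ + 1)) ⟨τ + 1, le_trans hτ (Nat.le_succ τ), rfl⟩
    rw [hxs, ← ih] at hle
    have hbr : IsBestResponse (x τ) i (x τ i) := by
      refine ⟨hx.mem_actions hτ i, fun t ht => (hs.2 t ht).trans ?_⟩
      rwa [Function.update_eq_self]
    rw [hlazy τ i rfl hbr, Function.update_eq_self]

theorem outcomes_one_nonempty (G : Game) : (G.outcomes 1).Nonempty := by
  obtain ⟨x, hx, -⟩ := exists_isWalk (G := G) fun p i => p i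
  refine ⟨x G.n, x, hx, fun m hm => ?_, fun h => absurd h (by simp)⟩
  have : m = 1 := by exact_mod_cast hm.symm
  rw [this, one_mul]

theorem outcomes_top_nonempty (hn : 0 < G.n) : (G.outcomes ⊤).Nonempty := by
  obtain ⟨x, hx, a, ha⟩ := exists_eventually_const hn
  refine ⟨a, x, hx, fun m hm => absurd hm (by simp), fun _ => ?_⟩
  exact (tendsto_id.atTop_mul_const' hn).eventually ha

/-- After one round, the utility is at least what the agents of a joint action `b` would add on top
of the final loads: each of them faced smaller loads on its turn, and could have chosen its part of
`b`. -/
theorem sum_le_utility_of_mem_outcomes_one (hD : ∀ r, IsSubmodularRule (G.distributionRule r))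
    {a b : G.Profile} (ha : a ∈ G.outcomes 1) (hb : b ∈ G.jointActions) :
    ∑ r, load b r * (G.distributionRule r (load a r + 1) - G.distributionRule r (load a r))
      ≤ utility a := by
  obtain ⟨x, hx, hxa, -⟩ := ha
  have hxa : x G.n = a := by simpa using hxa 1 (by simp)
  have hround (i : ℕ) (hi : i ≤ G.n) (j : Fin G.n) : x i j = if (j : ℕ) < i then a j else ∅ := by
    have h := hx.within_round 0 i hi j
    simpa [hxa, hx.1] using h
  have hU0 : utility (x 0) = 0 := by
    simp [utility, load, hx.1, (hD _).zero]
  have htel : ∑ i : Fin G.n, (utility (x (i + 1)) - utility (x i)) = utility a := by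
    rw [Fin.sum_univ_eq_sum_range (fun i => utility (x (i + 1)) - utility (x i)) G.n,
      Finset.sum_range_sub (fun i => utility (x i)), hxa, hU0, sub_zero]
  rw [← htel, ← sum_sum_mem]
  refine Finset.sum_le_sum fun i _ => ?_
  have hxi : x i i = ∅ := by
    rw [hround i i.2.le, if_neg (lt_irrefl _)]
  have hmove := hx.end_mem 0 i
  simp only [zero_mul, zero_add, one_mul, hxa] at hmove
  have hi : utility (x i) = utility (Function.update (x i) i ∅) := by
    rw [← hxi, Function.update_eq_self]
  rw [hmove.2, hi, utility_update, utility_update]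
  have hbi := (isBestResponse_iff.1 hmove.1).2 (b i) (Fintype.mem_piFinset.1 hb i)
  have hle : ∑ r ∈ b i,
      (G.distributionRule r (load a r + 1) - G.distributionRule r (load a r))
        ≤ gain (x i) i (b i) := by
    refine Finset.sum_le_sum fun r _ => (hD r).concave ?_
    refine Finset.card_le_card fun j hj => ?_
    simp only [Finset.mem_filter, Finset.mem_univ, true_and] at hj ⊢
    have := hj.2
    rw [hround i i.2.le j] at this
    split_ifs at this with h
    · exact this
    · simp at this
  have h0 : gain (x i) i ∅ = 0 := by simp [gain]
  linarith

/-- In a limit of a trajectory every agent plays a best response. -/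
theorem isBestResponse_of_mem_outcomes_top {a : G.Profile} (ha : a ∈ G.outcomes ⊤) (i : Fin G.n) :
    IsBestResponse a i (a i) := by
  obtain ⟨x, hx, -, hxa⟩ := ha
  obtain ⟨m, hm⟩ := eventually_atTop.1 (hxa rfl)
  have hm0 := hm m le_rfl
  have hm1 := hm (m + 1) (Nat.le_succ m)
  have hxi : x (m * G.n + i) = a := by
    funext j
    rw [hx.within_round m i i.2.le j, hm0, hm1, ite_self]
  have h := (hx.end_mem m i).1
  rwa [hxi, hm1] at h

/-- The equilibrium condition, summed over the agents. For a load of `0` the right-hand term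
vanishes, whatever the increment at the truncated `load a r - 1`. -/
theorem sum_le_sum_of_mem_outcomes_top (hD : ∀ r, IsSubmodularRule (G.distributionRule r))
    {a b : G.Profile} (ha : a ∈ G.outcomes ⊤) (hb : b ∈ G.jointActions) :
    ∑ r, load b r * (G.distributionRule r (load a r + 1) - G.distributionRule r (load a r))
      ≤ ∑ r, load a r *
        (G.distributionRule r (load a r - 1 + 1) - G.distributionRule r (load a r - 1)) := by
  rw [← sum_sum_mem, ← sum_sum_mem]
  refine Finset.sum_le_sum fun i _ => ?_
  have hbi := (isBestResponse_iff.1 (isBestResponse_of_mem_outcomes_top ha i)).2 (b i)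
    (Fintype.mem_piFinset.1 hb i)
  calc _ ≤ gain a i (b i) := Finset.sum_le_sum fun r _ => (hD r).concave (othersLoad_le a i r)
    _ ≤ gain a i (a i) := hbi
    _ = _ := by
      refine Finset.sum_congr rfl fun r hr => ?_
      rw [load_eq_othersLoad a i r, if_pos hr, Nat.add_sub_cancel]

end Game

/-! ### Guarantees -/

section guarantee

variable {𝒲 : Set (ℕ → ℝ)} {Γ : (ℕ → ℝ) → ℕ → ℝ} {G : Game} {k : ℕ∞} {ρ : ℝ}

theorem pos_of_mem_games (h𝒲 : ∀ w ∈ 𝒲, w 0 = 0) (hG : G ∈ games 𝒲 Γ) : 0 < G.n := by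
  by_contra hn
  have : IsEmpty (Fin G.n) := by
    rw [Nat.eq_zero_of_not_pos hn]
    infer_instance
  refine hG.2.ne' (le_antisymm ?_ hG.2.le)
  refine Finset.sup'_le _ _ fun a _ => le_of_eq ?_
  simp [Game.welfare, Game.load, h𝒲 _ (hG.1 _).1]

theorem welfare_nonneg (h𝒲 : ∀ w ∈ 𝒲, ∀ j, 0 ≤ w j) (hG : G ∈ games 𝒲 Γ) (a : G.Profile) :
    0 ≤ Game.welfare a :=
  Finset.sum_nonneg fun r _ => h𝒲 _ (hG.1 r).1 _

theorem efficiency_nonneg (h𝒲 : ∀ w ∈ 𝒲, ∀ j, 0 ≤ w j) (hG : G ∈ games 𝒲 Γ) :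
    0 ≤ G.efficiency k := by
  refine Real.sInf_nonneg ?_
  rintro _ ⟨a, -, rfl⟩
  exact div_nonneg (welfare_nonneg h𝒲 hG a) hG.2.le

theorem le_efficiency (hG : G ∈ games 𝒲 Γ) (hne : (G.outcomes k).Nonempty)
    (h : ∀ a ∈ G.outcomes k, ∀ b ∈ G.jointActions, ρ * Game.welfare b ≤ Game.welfare a) :
    ρ ≤ G.efficiency k := by
  refine le_csInf (hne.image _) ?_
  rintro _ ⟨a, ha, rfl⟩
  obtain ⟨b, hb, hopt⟩ :=
    Finset.exists_mem_eq_sup' G.jointActions_nonempty (Game.welfare (G := G))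
  have hopt : G.optWelfare = Game.welfare b := hopt
  simp only
  rw [le_div_iff₀ hG.2, hopt]
  exact h a ha b hb

theorem efficiency_le (h𝒲 : ∀ w ∈ 𝒲, ∀ j, 0 ≤ w j) (hG : G ∈ games 𝒲 Γ) {a b : G.Profile}
    (ha : a ∈ G.outcomes k) (hb : b ∈ G.jointActions) (hpos : 0 < Game.welfare b) :
    G.efficiency k ≤ Game.welfare a / Game.welfare b :=
  (csInf_le (Set.toFinite _).bddBelow (Set.mem_image_of_mem _ ha)).trans
    (div_le_div_of_nonneg_left (welfare_nonneg h𝒲 hG a) hpos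
      (Finset.le_sup' (f := Game.welfare (G := G)) hb))

theorem guarantee_le (h𝒲 : ∀ w ∈ 𝒲, ∀ j, 0 ≤ w j) (hG : G ∈ games 𝒲 Γ)
    (h : G.efficiency k ≤ ρ) : guarantee 𝒲 Γ k ≤ ρ := by
  refine (csInf_le ⟨0, ?_⟩ (Set.mem_image_of_mem _ hG)).trans h
  rintro _ ⟨G, hG, rfl⟩
  exact efficiency_nonneg h𝒲 hG

theorem optGuarantee_eq (hle : ∀ Γ, IsUtilityDesign 𝒲 Γ → guarantee 𝒲 Γ k ≤ ρ)
    (hΓ : IsUtilityDesign 𝒲 Γ) (h : ρ ≤ guarantee 𝒲 Γ k) : optGuarantee 𝒲 k = ρ := by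
  have hmem : guarantee 𝒲 Γ k ∈ (fun Γ => guarantee 𝒲 Γ k) '' {Γ | IsUtilityDesign 𝒲 Γ} :=
    ⟨Γ, hΓ, rfl⟩
  have hub : ∀ y ∈ (fun Γ => guarantee 𝒲 Γ k) '' {Γ | IsUtilityDesign 𝒲 Γ}, y ≤ ρ := by
    rintro _ ⟨Γ', hΓ', rfl⟩
    exact hle Γ' hΓ'
  exact le_antisymm (csSup_le ⟨_, hmem⟩ hub) (h.trans (le_csSup ⟨ρ, hub⟩ hmem))

end guarantee

theorem nonneg_of_mem {c : ℝ} : ∀ w ∈ rulesOfCurvatureAtMost c, ∀ j, 0 ≤ w j := fun w hw j => by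
  rw [← hw.1.zero]
  exact hw.1.mono (Nat.zero_le j)

section lower

variable {c : ℝ} {Γ : (ℕ → ℝ) → ℕ → ℝ}

theorem isSubmodularRule_distributionRule {𝒲 : Set (ℕ → ℝ)} (hΓ : IsUtilityDesign 𝒲 Γ) {G : Game}
    (hG : G ∈ games 𝒲 Γ) (r : Fin G.d) : IsSubmodularRule (G.distributionRule r) := by
  rw [(hG.1 r).2]
  exact (hΓ _ (hG.1 r).1).1

/-- A comparison of loads at every single resource gives a guarantee after one round. -/
theorem mul_welfare_le_of_mem_outcomes_one (hΓ : IsUtilityDesign (rulesOfCurvatureAtMost c) Γ)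
    {ρ κ μ : ℝ} (hμ : 0 ≤ μ)
    (h : ∀ w ∈ rulesOfCurvatureAtMost c, ∀ x y : ℕ,
      ρ * w y ≤ κ * w x + μ * (y * (Γ w (x + 1) - Γ w x) - Γ w x))
    {G : Game} (hG : G ∈ games (rulesOfCurvatureAtMost c) Γ) {a b : G.Profile}
    (ha : a ∈ G.outcomes 1) (hb : b ∈ G.jointActions) :
    ρ * Game.welfare b ≤ κ * Game.welfare a := by
  have h1 := Game.sum_le_utility_of_mem_outcomes_one (isSubmodularRule_distributionRule hΓ hG) ha hb
  have h2 : ρ * Game.welfare b ≤ κ * Game.welfare a + μ * (∑ r, Game.load b r *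
      (G.distributionRule r (Game.load a r + 1) - G.distributionRule r (Game.load a r))
        - Game.utility a) := by
    rw [Game.utility, ← Finset.sum_sub_distrib, Game.welfare, Game.welfare, Finset.mul_sum,
      Finset.mul_sum, Finset.mul_sum, ← Finset.sum_add_distrib]
    refine Finset.sum_le_sum fun r _ => ?_
    rw [(hG.1 r).2]
    exact h _ (hG.1 r).1 _ _
  linarith [mul_nonneg hμ (sub_nonneg.2 h1)]

theorem guarantee_oneRoundDesign_ge (hc₁ : c ≤ 1)
    (hne : (games (rulesOfCurvatureAtMost c) (oneRoundDesign c)).Nonempty) :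
    1 - c / 2 ≤ guarantee (rulesOfCurvatureAtMost c) (oneRoundDesign c) 1 := by
  refine le_csInf (hne.image _) ?_
  rintro _ ⟨G, hG, rfl⟩
  refine le_efficiency hG G.outcomes_one_nonempty fun a ha b hb => ?_
  have h := mul_welfare_le_of_mem_outcomes_one (κ := 1) (isUtilityDesign_oneRoundDesign hc₁)
    (by linarith : 0 ≤ 1 - c / 2)
    (fun w hw x y => by simpa using smoothness_oneRoundDesign hc₁ hw x y) hG ha hb
  simpa using h

theorem guarantee_limitDesign_ge (hc₁ : c ≤ 1)
    (hne : (games (rulesOfCurvatureAtMost c) (limitDesign c)).Nonempty) :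
    1 - c / Real.exp 1 ≤ guarantee (rulesOfCurvatureAtMost c) (limitDesign c) ⊤ := by
  refine le_csInf (hne.image _) ?_
  rintro _ ⟨G, hG, rfl⟩
  have hn := pos_of_mem_games (fun w hw => hw.1.zero) hG
  refine le_efficiency hG (Game.outcomes_top_nonempty hn) fun a ha b hb => ?_
  have h1 := Game.sum_le_sum_of_mem_outcomes_top
    (isSubmodularRule_distributionRule (isUtilityDesign_limitDesign hc₁) hG) ha hb
  have h2 : (1 - c / Real.exp 1) * Game.welfare b ≤ Game.welfare a
      + (1 - c / Real.exp 1) * (∑ r, Game.load b r *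
          (G.distributionRule r (Game.load a r + 1) - G.distributionRule r (Game.load a r))
        - ∑ r, Game.load a r *
          (G.distributionRule r (Game.load a r - 1 + 1)
            - G.distributionRule r (Game.load a r - 1))) := by
    rw [← Finset.sum_sub_distrib, Game.welfare, Game.welfare, Finset.mul_sum, Finset.mul_sum,
      ← Finset.sum_add_distrib]
    refine Finset.sum_le_sum fun r _ => ?_
    rw [(hG.1 r).2]
    exact smoothness_limitDesign hc₁ (hG.1 r).1 _ _
  linarith [mul_nonneg (one_sub_div_exp_pos hc₁).le (sub_nonneg.2 h1)]

theorem inv_mul_welfare_le_commonInterest (hc₀ : 0 ≤ c) (hc₁ : c ≤ 1) {G : Game}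
    (hG : G ∈ games (rulesOfCurvatureAtMost c) commonInterest) {a b : G.Profile}
    (ha : a ∈ G.outcomes 1) (hb : b ∈ G.jointActions) :
    (1 + c)⁻¹ * Game.welfare b ≤ Game.welfare a := by
  have h := mul_welfare_le_of_mem_outcomes_one (ρ := 1) (κ := 1 + c)
    (isUtilityDesign_commonInterest c) zero_le_one
    (fun w hw x y => by
      have := smoothness_commonInterest hc₁ hw x y
      simp only [commonInterest, id]
      linarith) hG ha hb
  rw [inv_mul_le_iff₀ (by linarith)]
  linarith

theorem guarantee_commonInterest_one_ge (hc₀ : 0 ≤ c) (hc₁ : c ≤ 1)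
    (hne : (games (rulesOfCurvatureAtMost c) commonInterest).Nonempty) :
    (1 + c)⁻¹ ≤ guarantee (rulesOfCurvatureAtMost c) commonInterest 1 := by
  refine le_csInf (hne.image _) ?_
  rintro _ ⟨G, hG, rfl⟩
  exact le_efficiency hG G.outcomes_one_nonempty fun a ha b hb =>
    inv_mul_welfare_le_commonInterest hc₀ hc₁ hG ha hb

/-- Under the common-interest design the utility is the welfare, so that later rounds can only
improve on the first. -/
theorem guarantee_commonInterest_top_ge (hc₀ : 0 ≤ c) (hc₁ : c ≤ 1)
    (hne : (games (rulesOfCurvatureAtMost c) commonInterest).Nonempty) :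
    (1 + c)⁻¹ ≤ guarantee (rulesOfCurvatureAtMost c) commonInterest ⊤ := by
  refine le_csInf (hne.image _) ?_
  rintro _ ⟨G, hG, rfl⟩
  have hn := pos_of_mem_games (fun w hw => hw.1.zero) hG
  refine le_efficiency hG (Game.outcomes_top_nonempty hn) fun a ha b hb => ?_
  obtain ⟨x, hx, -, hxa⟩ := ha
  obtain ⟨m, hm⟩ := eventually_atTop.1 (hxa rfl)
  have hUW (p : G.Profile) : Game.utility p = Game.welfare p := by
    simp [Game.utility, Game.welfare, (hG.1 _).2, commonInterest]
  have hfirst : x G.n ∈ G.outcomes 1 := by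
    refine ⟨x, hx, fun m hm => ?_, fun h => absurd h (by simp)⟩
    have : m = 1 := by exact_mod_cast hm.symm
    rw [this, one_mul]
  have hmono := hx.utility_mono hn le_rfl (Nat.le_mul_of_pos_left G.n m.succ_pos)
  rw [hm (m + 1) (Nat.le_succ m), hUW, hUW] at hmono
  exact (inv_mul_welfare_le_commonInterest hc₀ hc₁ hG hfirst hb).trans hmono

end lower

/-! ### Games with two actions per agent -/

section twoActionGame

variable {R : Type*} [Fintype R] {n : ℕ}

/-- The game in which every agent chooses between its action in `a` and its action in `b`. The
resources form an arbitrary finite type, which is numbered to obtain a `Game`. -/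
abbrev twoActionGame (w : R → ℕ → ℝ) (F : R → ℕ → ℝ) (a b : Fin n → Finset R) : Game where
  n := n
  d := Fintype.card R
  actions i := {(a i).map (Fintype.equivFin R).toEmbedding,
    (b i).map (Fintype.equivFin R).toEmbedding}
  actions_nonempty _ := Finset.insert_nonempty _ _
  welfareRule r := w ((Fintype.equivFin R).symm r)
  distributionRule r := F ((Fintype.equivFin R).symm r)

variable {w : R → ℕ → ℝ} {F : R → ℕ → ℝ} {a b : Fin n → Finset R}

/-- The profile of a two-action game that corresponds to a choice of sets of resources. -/
def toProfile (w : R → ℕ → ℝ) (F : R → ℕ → ℝ) (a b p : Fin n → Finset R) :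
    (twoActionGame w F a b).Profile :=
  fun i => (p i).map (Fintype.equivFin R).toEmbedding

theorem mem_actions_iff {i : Fin n} {s : Finset (Fin (Fintype.card R))} :
    s ∈ (twoActionGame w F a b).actions i
      ↔ s = toProfile w F a b a i ∨ s = toProfile w F a b b i := by
  simp only [twoActionGame, Finset.mem_insert, Finset.mem_singleton, toProfile]

theorem toProfile_mem_jointActions : toProfile w F a b b ∈ (twoActionGame w F a b).jointActions :=
  Fintype.mem_piFinset.2 fun _ => mem_actions_iff.2 (Or.inr rfl)

variable [DecidableEq R]

/-- The number of agents that use the resource `r`, counting only the agents in `E`. -/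
def loadAmong (E : Finset (Fin n)) (p : Fin n → Finset R) (r : R) : ℕ :=
  (E.filter fun j => r ∈ p j).card

/-- The utility added by the action `t` when the agents in `E` play as in `p` and the others use no
resources. -/
def gainOver (F : R → ℕ → ℝ) (E : Finset (Fin n)) (p : Fin n → Finset R) (t : Finset R) : ℝ :=
  ∑ r ∈ t, (F r (loadAmong E p r + 1) - F r (loadAmong E p r))

/-- The total welfare of `p` under the rules `w`, for an arbitrary finite type of resources. -/
def totalWelfare (w : R → ℕ → ℝ) (p : Fin n → Finset R) : ℝ :=
  ∑ r, w r (loadAmong Finset.univ p r)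

theorem welfare_toProfile (p : Fin n → Finset R) :
    Game.welfare (toProfile w F a b p) = totalWelfare w p := by
  refine Fintype.sum_equiv (Fintype.equivFin R).symm _ _ fun r => ?_
  simp only [Game.load, loadAmong, toProfile, twoActionGame, Finset.mem_map_equiv]

theorem gain_toProfile (p : Fin n → Finset R) (i : Fin n) (t : Finset R) :
    Game.gain (G := twoActionGame w F a b) (toProfile w F a b p) i
        (t.map (Fintype.equivFin R).toEmbedding)
      = gainOver F (Finset.univ.erase i) p t := by
  have ho (r : R) : Game.othersLoad (G := twoActionGame w F a b) (toProfile w F a b p) i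
      (Fintype.equivFin R r) = loadAmong (Finset.univ.erase i) p r := by
    refine congrArg Finset.card ?_
    ext j
    simp [toProfile]
  rw [Game.gain, Finset.sum_map]
  refine Finset.sum_congr rfl fun r _ => ?_
  simp only [Equiv.coe_toEmbedding]
  rw [ho]
  simp

theorem twoActionGame_mem_games {𝒲 : Set (ℕ → ℝ)} {Γ : (ℕ → ℝ) → ℕ → ℝ} (hw : ∀ r, w r ∈ 𝒲)
    (hpos : 0 < totalWelfare w b) : twoActionGame w (fun r => Γ (w r)) a b ∈ games 𝒲 Γ := by
  refine ⟨fun r => ⟨hw _, rfl⟩, hpos.trans_le ?_⟩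
  rw [← welfare_toProfile (F := fun r => Γ (w r)) (a := a) (b := b)]
  exact Finset.le_sup' _ toProfile_mem_jointActions

/-- If, on its turn in the first round, no agent gains by its action in `b` rather than in `a`, then
some trajectory reaches `a` after one round; if this is an equilibrium, then it stays there. -/
theorem exists_walk_to
    (hgreedy : ∀ i, gainOver F (Finset.Iio i) a (b i) ≤ gainOver F (Finset.Iio i) a (a i)) :
    ∃ x : ℕ → (twoActionGame w F a b).Profile, Game.IsWalk x ∧ x n = toProfile w F a b a ∧
      ((∀ i, gainOver F (Finset.univ.erase i) a (b i) ≤ gainOver F (Finset.univ.erase i) a (a i)) →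
        ∀ τ, n ≤ τ → x τ = toProfile w F a b a) := by
  obtain ⟨x, hx, hpref⟩ := Game.exists_isWalk (G := twoActionGame w F a b)
    fun _ i => toProfile w F a b a i
  have hbr (p : Fin n → Finset R) (i : Fin n)
      (h : gainOver F (Finset.univ.erase i) p (b i) ≤ gainOver F (Finset.univ.erase i) p (a i)) :
      Game.IsBestResponse (G := twoActionGame w F a b) (toProfile w F a b p) i
        (toProfile w F a b a i) := by
    refine Game.isBestResponse_iff.2 ⟨mem_actions_iff.2 (Or.inl rfl), fun t ht => ?_⟩
    rcases mem_actions_iff.1 ht with rfl | rfl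
    · exact le_rfl
    · simp only [toProfile]
      refine (gain_toProfile p i (b i)).trans_le (h.trans (gain_toProfile p i (a i)).ge)
  have hround (τ : ℕ) (hτ : τ ≤ n) :
      x τ = toProfile w F a b fun j => if (j : ℕ) < τ then a j else ∅ := by
    induction τ with
    | zero =>
      rw [hx.1]
      funext j
      simp [toProfile]
    | succ τ ih =>
      let i : Fin n := ⟨τ, hτ⟩
      have hx' := ih (Nat.le_of_succ_le hτ)
      have hgain (t : Finset R) : gainOver F (Finset.univ.erase i)
          (fun j => if (j : ℕ) < τ then a j else ∅) t = gainOver F (Finset.Iio i) a t := by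
        have hl (r : R) : loadAmong (Finset.univ.erase i)
            (fun j => if (j : ℕ) < τ then a j else ∅) r = loadAmong (Finset.Iio i) a r := by
          refine congrArg Finset.card ?_
          ext j
          by_cases hj : (j : ℕ) < τ
          · have : j ≠ i := fun h => hj.ne (congrArg Fin.val h)
            simp [hj, this, Fin.lt_def, i]
          · simp [hj, Fin.lt_def, i]
        simp only [gainOver, hl]
      have hstep := hpref τ i (Nat.mod_eq_of_lt hτ).symm
      rw [hx'] at hstep
      rw [hstep (hbr _ i (by rw [hgain, hgain]; exact hgreedy i))]
      funext j
      rcases eq_or_ne j i with rfl | hj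
      · simp [toProfile, i]
      · have hne : (j : ℕ) ≠ τ := fun h => hj (Fin.ext h)
        have hiff : (j : ℕ) < τ + 1 ↔ (j : ℕ) < τ := by omega
        simp [toProfile, hj, hiff]
  have hxn : x n = toProfile w F a b a := by
    rw [hround n le_rfl]
    simp
  refine ⟨x, hx, hxn, fun hnash τ hτ => ?_⟩
  induction τ, hτ using Nat.le_induction with
  | base => exact hxn
  | succ τ hτ ih =>
    rcases Nat.eq_zero_or_pos n with rfl | hn
    · exact Subsingleton.elim (α := Fin 0 → Finset (Fin (Fintype.card R))) _ _
    · have hstep := hpref τ ⟨τ % n, Nat.mod_lt τ hn⟩ rfl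
      rw [ih] at hstep
      rw [hstep (hbr _ _ (hnash _)), Function.update_eq_self]

variable {𝒲 : Set (ℕ → ℝ)} {Γ : (ℕ → ℝ) → ℕ → ℝ}

theorem guarantee_one_le_of_greedy (h𝒲 : ∀ w ∈ 𝒲, ∀ j, 0 ≤ w j) (hw : ∀ r, w r ∈ 𝒲)
    (hpos : 0 < totalWelfare w b)
    (hgreedy : ∀ i, gainOver (fun r => Γ (w r)) (Finset.Iio i) a (b i)
      ≤ gainOver (fun r => Γ (w r)) (Finset.Iio i) a (a i)) :
    guarantee 𝒲 Γ 1 ≤ totalWelfare w a / totalWelfare w b := by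
  have hG := twoActionGame_mem_games (Γ := Γ) (a := a) hw hpos
  obtain ⟨x, hx, hxn, -⟩ := exists_walk_to (w := w) hgreedy
  have hout : toProfile w (fun r => Γ (w r)) a b a
      ∈ (twoActionGame w (fun r => Γ (w r)) a b).outcomes 1 := by
    refine ⟨x, hx, fun m hm => ?_, fun h => absurd h (by simp)⟩
    have : m = 1 := by exact_mod_cast hm.symm
    rw [this, one_mul]
    exact hxn
  have h := efficiency_le h𝒲 hG hout toProfile_mem_jointActions (by rwa [welfare_toProfile])
  rw [welfare_toProfile, welfare_toProfile] at h
  exact guarantee_le h𝒲 hG h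

theorem guarantee_top_le_of_nash (h𝒲 : ∀ w ∈ 𝒲, ∀ j, 0 ≤ w j) (hw : ∀ r, w r ∈ 𝒲)
    (hpos : 0 < totalWelfare w b)
    (hgreedy : ∀ i, gainOver (fun r => Γ (w r)) (Finset.Iio i) a (b i)
      ≤ gainOver (fun r => Γ (w r)) (Finset.Iio i) a (a i))
    (hnash : ∀ i, gainOver (fun r => Γ (w r)) (Finset.univ.erase i) a (b i)
      ≤ gainOver (fun r => Γ (w r)) (Finset.univ.erase i) a (a i)) :
    guarantee 𝒲 Γ ⊤ ≤ totalWelfare w a / totalWelfare w b := by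
  have hG := twoActionGame_mem_games (Γ := Γ) (a := a) hw hpos
  obtain ⟨x, hx, -, hxa⟩ := exists_walk_to (w := w) hgreedy
  have hout : toProfile w (fun r => Γ (w r)) a b a
      ∈ (twoActionGame w (fun r => Γ (w r)) a b).outcomes ⊤ := by
    refine ⟨x, hx, fun m hm => absurd hm (by simp), fun _ => ?_⟩
    filter_upwards [eventually_ge_atTop 1] with m hm
    exact hxa hnash _ (Nat.le_mul_of_pos_left n hm)
  have h := efficiency_le h𝒲 hG hout toProfile_mem_jointActions (by rwa [welfare_toProfile])
  rw [welfare_toProfile, welfare_toProfile] at h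
  exact guarantee_le h𝒲 hG h

end twoActionGame

/-! ### One round: two agents and two resources -/

section oneRound

variable {c : ℝ}

/-- Both agents use the first resource. -/
def sharing : Fin 2 → Finset (Fin 2) :=
  fun _ => {0}

/-- The first agent moves out of the way, to the second resource. -/
def separate : Fin 2 → Finset (Fin 2) :=
  ![{1}, {0}]

theorem totalWelfare_sharing (c : ℝ) : totalWelfare (fun _ => coverRule c) sharing = 2 - c := by
  simp [totalWelfare, loadAmong, sharing, Fin.sum_univ_two]

theorem totalWelfare_separate (c : ℝ) : totalWelfare (fun _ => coverRule c) separate = 2 := by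
  have h (r : Fin 2) : loadAmong Finset.univ separate r = 1 := by
    revert r
    decide
  simp [totalWelfare, h]

theorem games_nonempty (hc₀ : 0 ≤ c) (hc₁ : c ≤ 1) (Γ : (ℕ → ℝ) → ℕ → ℝ) :
    (games (rulesOfCurvatureAtMost c) Γ).Nonempty :=
  ⟨_, twoActionGame_mem_games (a := sharing) (fun _ => coverRule_mem hc₀ hc₁)
    (two_pos.trans_eq (totalWelfare_separate c).symm)⟩

/-- The first agent is indifferent between the two resources, and the second agent has only one of
them at its disposal. Both may end up on the same resource. -/
theorem guarantee_one_le (hc₀ : 0 ≤ c) (hc₁ : c ≤ 1) (Γ : (ℕ → ℝ) → ℕ → ℝ) :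
    guarantee (rulesOfCurvatureAtMost c) Γ 1 ≤ 1 - c / 2 := by
  have hgreedy (i : Fin 2) :
      gainOver (fun _ => Γ (coverRule c)) (Finset.Iio i) sharing (separate i)
        ≤ gainOver (fun _ => Γ (coverRule c)) (Finset.Iio i) sharing (sharing i) := by
    fin_cases i
    · simp [gainOver, loadAmong, sharing, separate]
    · exact le_rfl
  have h := guarantee_one_le_of_greedy nonneg_of_mem (fun _ => coverRule_mem hc₀ hc₁)
    (two_pos.trans_eq (totalWelfare_separate c).symm) hgreedy
  rw [totalWelfare_sharing, totalWelfare_separate] at h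
  linarith

end oneRound

/-! ### Common interest: a chain of agents -/

section chain

variable {c : ℝ} {n : ℕ}

/-- The rules of the chain game: every agent has a resource of value `1` and one of value `c`. -/
def chainRule (c : ℝ) (r : Fin (n + 1) × Bool) (j : ℕ) : ℝ :=
  (if r.2 then c else 1) * coverRule c j

/-- In the bad outcome of the chain game every agent uses its own resource of value `1`. -/
def chainStay (i : Fin (n + 1)) : Finset (Fin (n + 1) × Bool) :=
  {(i, false)}

/-- In the good outcome of the chain game every agent but the first one joins the resource of value
`1` of its predecessor, and uses its own resource of value `c`. -/
def chainShift : Fin (n + 1) → Finset (Fin (n + 1) × Bool) :=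
  Fin.cases {(0, false)} fun i => {(i.castSucc, false), (i.succ, true)}

theorem chainRule_mem (hc₀ : 0 < c) (hc₁ : c ≤ 1) (r : Fin (n + 1) × Bool) :
    chainRule c r ∈ rulesOfCurvatureAtMost c :=
  mul_coverRule_mem hc₀.le hc₁ (by split_ifs <;> positivity)

theorem chainRule_mono (hc₀ : 0 < c) (hc₁ : c ≤ 1) (r : Fin (n + 1) × Bool) :
    Monotone (chainRule c r) :=
  (chainRule_mem hc₀ hc₁ r).1.mono

theorem loadAmong_chainStay_false (E : Finset (Fin (n + 1))) (i : Fin (n + 1)) :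
    loadAmong E chainStay (i, false) = if i ∈ E then 1 else 0 := by
  have : (E.filter fun j => (i, false) ∈ chainStay j) = if i ∈ E then {i} else ∅ := by
    ext j
    by_cases hi : i ∈ E
    · simp only [chainStay, Finset.mem_filter, Finset.mem_singleton, Prod.mk.injEq, and_true, hi,
        if_true]
      exact ⟨fun h => h.2.symm, fun h => ⟨h ▸ hi, h.symm⟩⟩
    · simp only [chainStay, Finset.mem_filter, Finset.mem_singleton, Prod.mk.injEq, and_true, hi,
        if_false, Finset.notMem_empty, iff_false]
      exact fun h => hi (h.2 ▸ h.1)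
  rw [loadAmong, this]
  split_ifs <;> simp

theorem loadAmong_chainStay_true (E : Finset (Fin (n + 1))) (i : Fin (n + 1)) :
    loadAmong E chainStay (i, true) = 0 := by
  simp [loadAmong, chainStay]

/-- An agent that sees its predecessor in place gets the value `1 - c` by joining it, and thus the
value `1` in total from both actions. -/
theorem gainOver_chainShift_le (E : Finset (Fin (n + 1))) (i : Fin (n + 1)) (hi : i ∉ E)
    (hE : Finset.Iio i ⊆ E) :
    gainOver (chainRule c) E chainStay (chainShift i)
      ≤ gainOver (chainRule c) E chainStay (chainStay i) := by
  induction i using Fin.cases with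
  | zero => exact le_rfl
  | succ i =>
    have hmem : i.castSucc ∈ E := hE (Finset.mem_Iio.2 (Fin.castSucc_lt_succ))
    have hne : ((i.castSucc, false) : Fin (n + 1) × Bool) ≠ (i.succ, true) := by simp
    simp only [gainOver, chainShift, Fin.cases_succ]
    rw [Finset.sum_pair hne, loadAmong_chainStay_false, loadAmong_chainStay_true, if_pos hmem,
      chainStay, Finset.sum_singleton, loadAmong_chainStay_false, if_neg hi]
    simp only [chainRule, zero_add, Nat.reduceAdd, coverRule_zero, coverRule_one, coverRule_two,
      if_true, Bool.false_eq_true, if_false]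
    linarith

theorem totalWelfare_chainStay : totalWelfare (chainRule c) (chainStay (n := n)) = n + 1 := by
  simp [totalWelfare, Fintype.sum_prod_type, loadAmong_chainStay_false, loadAmong_chainStay_true,
    chainRule]

theorem le_totalWelfare_chainShift (hc₀ : 0 < c) (hc₁ : c ≤ 1) :
    n * (1 + c) ≤ totalWelfare (chainRule c) (chainShift (n := n)) := by
  have hnn (r : Fin (n + 1) × Bool) (j : ℕ) : 0 ≤ chainRule c r j :=
    nonneg_of_mem _ (chainRule_mem hc₀ hc₁ r) j
  have hpos (i : Fin n) (r : Fin (n + 1) × Bool) (hr : r ∈ chainShift i.succ) :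
      1 ≤ loadAmong Finset.univ chainShift r :=
    Finset.card_pos.2 ⟨i.succ, by simpa using hr⟩
  have h1 (i : Fin n) :
      1 ≤ chainRule c (i.castSucc, false)
        (loadAmong Finset.univ chainShift (i.castSucc, false)) := by
    refine le_trans ?_ (chainRule_mono hc₀ hc₁ _ (hpos i _ (by simp [chainShift])))
    simp [chainRule]
  have h2 (i : Fin n) :
      c ≤ chainRule c (i.succ, true) (loadAmong Finset.univ chainShift (i.succ, true)) := by
    refine le_trans ?_ (chainRule_mono hc₀ hc₁ _ (hpos i _ (by simp [chainShift])))
    simp [chainRule]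
  rw [totalWelfare, Fintype.sum_prod_type]
  simp only [Fintype.sum_bool, Finset.sum_add_distrib]
  rw [Fin.sum_univ_succ (fun i : Fin (n + 1) => chainRule c (i, true) _), Fin.sum_univ_castSucc]
  have h1' := Finset.sum_le_sum fun i (_ : i ∈ Finset.univ) => h1 i
  have h2' := Finset.sum_le_sum fun i (_ : i ∈ Finset.univ) => h2 i
  simp only [Finset.sum_const, Finset.card_univ, Fintype.card_fin, nsmul_eq_mul, mul_one] at h1' h2'
  have h3 := hnn (0, true) (loadAmong Finset.univ (chainShift (n := n)) (0, true))
  have h4 := hnn (Fin.last n, false) (loadAmong Finset.univ chainShift (Fin.last n, false))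
  linarith

theorem guarantee_commonInterest_le_of_pos (hc₀ : 0 < c) (hc₁ : c ≤ 1) {k : ℕ∞}
    (hk : k = 1 ∨ k = ⊤) :
    guarantee (rulesOfCurvatureAtMost c) commonInterest k ≤ (1 + c)⁻¹ := by
  have hbound (n : ℕ) (hn : 0 < n) :
      guarantee (rulesOfCurvatureAtMost c) commonInterest k ≤ (1 + 1 / (n : ℝ)) * (1 + c)⁻¹ := by
    have hn' : (0 : ℝ) < n := Nat.cast_pos.2 hn
    have hle := le_totalWelfare_chainShift (n := n) hc₀ hc₁
    have hpos : 0 < totalWelfare (chainRule c) (chainShift (n := n)) :=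
      lt_of_lt_of_le (by positivity) hle
    have hgreedy (i : Fin (n + 1)) :=
      gainOver_chainShift_le (c := c) (Finset.Iio i) i (by simp) subset_rfl
    have hnash (i : Fin (n + 1)) :=
      gainOver_chainShift_le (c := c) (Finset.univ.erase i) i (by simp)
        fun j hj => by simpa using (Finset.mem_Iio.1 hj).ne
    have h : guarantee (rulesOfCurvatureAtMost c) commonInterest k
        ≤ totalWelfare (chainRule c) (chainStay (n := n))
          / totalWelfare (chainRule c) (chainShift (n := n)) := by
      rcases hk with rfl | rfl
      · exact guarantee_one_le_of_greedy nonneg_of_mem (chainRule_mem hc₀ hc₁) hpos hgreedy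
      · exact guarantee_top_le_of_nash nonneg_of_mem (chainRule_mem hc₀ hc₁) hpos hgreedy hnash
    refine h.trans ?_
    rw [totalWelfare_chainStay]
    refine (div_le_div_of_nonneg_left (by positivity) (by positivity) hle).trans_eq ?_
    field_simp
  have hlim : Tendsto (fun n : ℕ => (1 + 1 / (n : ℝ)) * (1 + c)⁻¹) atTop
      (𝓝 ((1 + 0) * (1 + c)⁻¹)) :=
    (tendsto_one_div_atTop_nhds_zero_nat.const_add 1).mul_const _
  rw [add_zero, one_mul] at hlim
  refine ge_of_tendsto hlim ?_
  filter_upwards [eventually_gt_atTop 0] with n hn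
  exact hbound n hn

end chain

/-! ### Limits: resources that are lists of agents -/

section lists

variable {n : ℕ}

/-- The lists of distinct agents. -/
abbrev NodupList (n : ℕ) : Type := {l : List (Fin n) // l.Nodup}

/-- In the bad outcome every agent uses the lists in which it does not occur. -/
def avoiding (i : Fin n) : Finset (NodupList n) :=
  Finset.univ.filter fun l => i ∉ l.1

/-- In the good outcome every agent uses the lists of which it is the head. -/
def headed (i : Fin n) : Finset (NodupList n) :=
  Finset.univ.filter fun l => l.1.head? = some i

/-- Putting `i` at the front of a list is a bijection from the lists without `i` to those with head
`i`. It does not affect the load caused by other agents. -/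
theorem sum_avoiding_eq_sum_headed (E : Finset (Fin n)) (i : Fin n) (hi : i ∉ E) (f : ℕ → ℝ) :
    ∑ l ∈ avoiding i, f (loadAmong E avoiding l) = ∑ l ∈ headed i, f (loadAmong E avoiding l) := by
  refine Finset.sum_bij (fun l hl => ⟨i :: l.1, ?_⟩) (fun l hl => ?_) (fun l hl l' hl' h => ?_)
    (fun l hl => ?_) fun l hl => ?_
  · exact List.nodup_cons.2 ⟨by simpa [avoiding] using hl, l.2⟩
  · simp [headed]
  · simpa [Subtype.ext_iff] using h
  · obtain ⟨l, hnd⟩ := l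
    rcases l with _ | ⟨j, l⟩
    · simp [headed] at hl
    · obtain rfl : j = i := by simpa [headed] using hl
      exact ⟨⟨l, (List.nodup_cons.1 hnd).2⟩, by simpa [avoiding] using (List.nodup_cons.1 hnd).1,
        rfl⟩
  · refine congrArg (fun s => f (Finset.card s)) (Finset.filter_congr fun j hj => ?_)
    have : j ≠ i := fun h => hi (h ▸ hj)
    simp [avoiding, this]

theorem loadAmong_headed (l : NodupList n) :
    loadAmong Finset.univ headed l = if l.1 = [] then 0 else 1 := by
  obtain ⟨l, hnd⟩ := l
  rcases l with _ | ⟨i, l⟩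
  · simp [loadAmong, headed]
  · have : (Finset.univ.filter fun j : Fin n => (⟨i :: l, hnd⟩ : NodupList n) ∈ headed j)
        = {i} := by
      ext j
      simp [headed, eq_comm]
    rw [loadAmong, this]
    simp

theorem loadAmong_avoiding (l : NodupList n) :
    loadAmong Finset.univ avoiding l = n - l.1.length := by
  have : (Finset.univ.filter fun j : Fin n => l ∈ avoiding j) = l.1.toFinsetᶜ := by
    ext j
    simp [avoiding]
  rw [loadAmong, this, Finset.card_compl, Fintype.card_fin, List.toFinset_card_of_nodup l.2]

theorem length_le (l : NodupList n) : l.1.length ≤ n := by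
  simpa using l.2.length_le_card

theorem card_length_eq (n m : ℕ) :
    (Finset.univ.filter fun l : NodupList n => l.1.length = m).card = n.descFactorial m := by
  have h : Fintype.card (Fin m ↪ Fin n) = n.descFactorial m := by simp
  rw [← h, ← Finset.card_univ]
  symm
  refine Finset.card_bij (fun f _ => ⟨List.ofFn f, List.nodup_ofFn.2 f.injective⟩) (fun f _ => ?_)
    (fun f _ g _ hfg => ?_) fun l hl => ?_
  · simp
  · exact DFunLike.coe_injective (List.ofFn_injective (Subtype.ext_iff.1 hfg))
  · obtain ⟨l, hnd⟩ := l
    obtain rfl : l.length = m := by simpa using hl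
    exact ⟨⟨l.get, List.nodup_iff_injective_get.1 hnd⟩, Finset.mem_univ _, by simp⟩

/-- The partial sums of the exponential series at `1`. -/
def expSum (n : ℕ) : ℝ :=
  ∑ k ∈ Finset.range n, 1 / (k.factorial : ℝ)

theorem tendsto_expSum : Tendsto expSum atTop (𝓝 (Real.exp 1)) := by
  have h := (NormedSpace.expSeries_div_hasSum_exp (1 : ℝ)).tendsto_sum_nat
  rw [← Real.exp_eq_exp_ℝ] at h
  exact h.congr fun n => by simp [expSum]

theorem card_nodupList (n : ℕ) :
    (Fintype.card (NodupList n) : ℝ) = n.factorial * expSum (n + 1) := by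
  have h : Fintype.card (NodupList n) = ∑ m ∈ Finset.range (n + 1), n.descFactorial m := by
    rw [← Finset.card_univ,
      Finset.card_eq_sum_card_fiberwise (f := fun l : NodupList n => l.1.length)
      (t := Finset.range (n + 1))
      fun l _ => Finset.mem_coe.2 (Finset.mem_range.2 (Nat.lt_succ_of_le (length_le l)))]
    exact Finset.sum_congr rfl fun m _ => card_length_eq n m
  rw [h, expSum, ← Finset.sum_range_reflect, Finset.mul_sum]
  push_cast
  refine Finset.sum_congr rfl fun m hm => ?_
  have hm : m ≤ n := Nat.lt_succ_iff.1 (Finset.mem_range.1 hm)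
  have hfac := Nat.factorial_mul_descFactorial (Nat.sub_le n m)
  rw [Nat.sub_sub_self hm] at hfac
  rw [← hfac]
  push_cast
  field_simp

theorem sum_loadAmong (a : Fin n → Finset (NodupList n)) :
    ∑ l, (loadAmong Finset.univ a l : ℝ) = ∑ i, ((a i).card : ℝ) := by
  simp only [loadAmong, Finset.card_filter]
  push_cast
  rw [Finset.sum_comm]
  simp

theorem sum_loadAmong_headed :
    ∑ l, (loadAmong Finset.univ (headed (n := n)) l : ℝ) = n.factorial * expSum n := by
  have h : ∑ l : NodupList n, (if l.1 = [] then (1 : ℝ) else 0) = 1 := by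
    rw [Finset.sum_eq_single ⟨[], List.nodup_nil⟩]
    · simp
    · intro l _ hl
      exact if_neg fun h => hl (Subtype.ext h)
    · simp
  have h2 : ∑ l, (loadAmong Finset.univ (headed (n := n)) l : ℝ)
      = Fintype.card (NodupList n) - 1 := by
    rw [← h, ← Finset.card_univ, Finset.card_eq_sum_ones]
    push_cast
    rw [← Finset.sum_sub_distrib]
    refine Finset.sum_congr rfl fun l _ => ?_
    rw [loadAmong_headed]
    split_ifs <;> simp
  rw [h2, card_nodupList, expSum, Finset.sum_range_succ, ← expSum, mul_add,
    mul_one_div_cancel (by positivity), add_sub_cancel_right]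

theorem sum_loadAmong_avoiding :
    ∑ l, (loadAmong Finset.univ (avoiding (n := n)) l : ℝ) = n.factorial * expSum n := by
  rw [← sum_loadAmong_headed, sum_loadAmong, sum_loadAmong]
  refine Finset.sum_congr rfl fun i _ => ?_
  simpa using sum_avoiding_eq_sum_headed ∅ i (by simp) fun _ => 1

theorem totalWelfare_headed (c : ℝ) :
    totalWelfare (fun _ => coverRule c) (headed (n := n)) = n.factorial * expSum n := by
  rw [← sum_loadAmong_headed]
  refine Finset.sum_congr rfl fun l _ => ?_
  rw [loadAmong_headed]
  split_ifs <;> simp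

/-- All lists are in use, except for those that contain all agents. -/
theorem totalWelfare_avoiding (c : ℝ) :
    totalWelfare (fun _ => coverRule c) (avoiding (n := n))
      = n.factorial * (c * (expSum (n + 1) - 1) + (1 - c) * expSum n) := by
  have hmin (l : NodupList n) : min (loadAmong Finset.univ avoiding l : ℝ) 1
      = 1 - if l.1.length = n then 1 else 0 := by
    rw [loadAmong_avoiding]
    have hl := length_le l
    split_ifs with h
    · simp [h]
    · rw [min_eq_right (by exact_mod_cast (by omega : 1 ≤ n - l.1.length)), sub_zero]
  simp only [totalWelfare, coverRule, Finset.sum_add_distrib, ← Finset.mul_sum, hmin,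
    Finset.sum_sub_distrib, sum_loadAmong_avoiding, Finset.sum_boole, card_length_eq,
    Nat.descFactorial_self, Finset.sum_const, Finset.card_univ, nsmul_eq_mul, mul_one,
    card_nodupList]
  ring

/-- For every design, all agents are always indifferent between their two actions in the game
on the lists. As the number of agents grows, the load of a random list in the bad outcome tends
to a Poisson variable of mean `1`. -/
theorem guarantee_top_le {c : ℝ} (hc₀ : 0 ≤ c) (hc₁ : c ≤ 1) (Γ : (ℕ → ℝ) → ℕ → ℝ) :
    guarantee (rulesOfCurvatureAtMost c) Γ ⊤ ≤ 1 - c / Real.exp 1 := by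
  have htie (n : ℕ) (E : Finset (Fin n)) (i : Fin n) (hi : i ∉ E) :
      gainOver (fun _ => Γ (coverRule c)) E avoiding (headed i)
        ≤ gainOver (fun _ => Γ (coverRule c)) E avoiding (avoiding i) :=
    (sum_avoiding_eq_sum_headed E i hi
      fun j => Γ (coverRule c) (j + 1) - Γ (coverRule c) j).ge
  have hbound (n : ℕ) (hn : 0 < n) : guarantee (rulesOfCurvatureAtMost c) Γ ⊤
      ≤ (c * (expSum (n + 1) - 1) + (1 - c) * expSum n) / expSum n := by
    have hfac : (0 : ℝ) < n.factorial := by positivity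
    have hpos : 0 < expSum n :=
      Finset.sum_pos (fun k _ => by positivity) (Finset.nonempty_range_iff.2 hn.ne')
    have h := guarantee_top_le_of_nash (Γ := Γ) (w := fun _ : NodupList n => coverRule c)
      (a := avoiding) (b := headed) nonneg_of_mem (fun _ => coverRule_mem hc₀ hc₁)
      (by rw [totalWelfare_headed]; positivity) (fun i => htie n _ i (by simp))
      fun i => htie n _ i (by simp)
    rwa [totalWelfare_avoiding, totalWelfare_headed, mul_div_mul_left _ _ hfac.ne'] at h
  have he := Real.exp_pos 1
  have hlim : Tendsto (fun n => (c * (expSum (n + 1) - 1) + (1 - c) * expSum n) / expSum n) atTop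
      (𝓝 ((c * (Real.exp 1 - 1) + (1 - c) * Real.exp 1) / Real.exp 1)) :=
    (((((tendsto_add_atTop_iff_nat 1).2 tendsto_expSum).sub_const 1).const_mul c).add
      (tendsto_expSum.const_mul (1 - c))).div tendsto_expSum he.ne'
  have heq : (c * (Real.exp 1 - 1) + (1 - c) * Real.exp 1) / Real.exp 1 = 1 - c / Real.exp 1 := by
    field_simp
    ring
  rw [← heq]
  refine ge_of_tendsto hlim ?_
  filter_upwards [eventually_gt_atTop 0] with n hn
  exact hbound n hn

end lists

/-- For `c = 0` the resources of value `c` in the chain game are not available, but the bounds that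
hold for every design suffice. -/
theorem guarantee_commonInterest_le {c : ℝ} (hc₀ : 0 ≤ c) (hc₁ : c ≤ 1) {k : ℕ∞}
    (hk : k = 1 ∨ k = ⊤) :
    guarantee (rulesOfCurvatureAtMost c) commonInterest k ≤ (1 + c)⁻¹ := by
  rcases hc₀.eq_or_lt with rfl | hc
  · rcases hk with rfl | rfl
    · simpa using guarantee_one_le le_rfl hc₁ commonInterest
    · simpa using guarantee_top_le le_rfl hc₁ commonInterest
  · exact guarantee_commonInterest_le_of_pos hc hc₁ hk

end RoundRobin

end

open RoundRobin in
theorem proposition1 (c : ℝ) (hc₀ : 0 ≤ c) (hc₁ : c ≤ 1) :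
    RoundRobin.optGuarantee (RoundRobin.rulesOfCurvatureAtMost c) 1 = 1 - c / 2 ∧
    RoundRobin.optGuarantee (RoundRobin.rulesOfCurvatureAtMost c) ⊤ = 1 - c / Real.exp 1 ∧
    RoundRobin.guarantee (RoundRobin.rulesOfCurvatureAtMost c) RoundRobin.commonInterest 1
      = (1 + c)⁻¹ ∧
    RoundRobin.guarantee (RoundRobin.rulesOfCurvatureAtMost c) RoundRobin.commonInterest ⊤
      = (1 + c)⁻¹ := by
  have hne := games_nonempty hc₀ hc₁
  exact ⟨optGuarantee_eq (fun Γ _ => guarantee_one_le hc₀ hc₁ Γ)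
      (isUtilityDesign_oneRoundDesign hc₁) (guarantee_oneRoundDesign_ge hc₁ (hne _)),
    optGuarantee_eq (fun Γ _ => guarantee_top_le hc₀ hc₁ Γ)
      (isUtilityDesign_limitDesign hc₁) (guarantee_limitDesign_ge hc₁ (hne _)),
    (guarantee_commonInterest_le hc₀ hc₁ (Or.inl rfl)).antisymm
      (guarantee_commonInterest_one_ge hc₀ hc₁ (hne _)),
    (guarantee_commonInterest_le hc₀ hc₁ (Or.inr rfl)).antisymm
      (guarantee_commonInterest_top_ge hc₀ hc₁ (hne _))⟩
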